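/- **Theorem 4.2.** Let $\alpha\in W^{2,1}(\mathbb R)$ be a real-valued kernel whose third distributional derivative $\alpha'''=\mu$ is a finite signed Borel measure on $\mathbb R$; let $\alpha'$ denote the continuous representative of its first derivative. Let $\kappa>0$, $s>9/2$, and let $f\in C^{[s]+1}(\mathbb R)$ be real-valued with $f(0)=0$. Let $T>0$, $\varphi\in H^s(\mathbb R)$, and let $u\in C^1([0,T],H^s(\mathbb R))$ be a (real-valued) solution of $$u_t+\alpha'*f(u)+\kappa\,\alpha'''*u=0\quad (x\in\mathbb R,\ 0<t\le T),\qquad u(x,0)=\varphi(x),$$ where $(\alpha'''*u)(x)=\int u(x-y)\,d\mu(y)$ and elements of $H^s(\mathbb R)$ are identified with their continuous representatives. For $h>0$ put $x_i=ih$ ($i\in\mathbb Z$) and $D_h^2\alpha'(x_i)=h^{-2}\big(\alpha'(x_{i+1})-2\alpha'(x_i)+\alpha'(x_{i-1})\big)$. For $N\in\mathbb N$ consider the system of $2N+1$ ordinary differential equations $$\frac{dv_i}{dt}=-\sum_{j=-N}^{N}h\,\alpha'(x_i-x_j)f(v_j)-\kappa\sum_{j=-N}^{N}h\,D_h^2\alpha'(x_i-x_j)\,v_j,\qquad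 v_i(0)=\varphi(ih),\qquad -N\le i\le N. \tag{4.1}$$ Then there are constants $h_0>0$ and $C$, depending only on the above data $(\alpha,\kappa,s,f,T,u)$, such that for every $0<h\le h_0$ and every $\varepsilon>0$ there is an $N_0$ such that for every $N\ge N_0$ the initial-value problem (4.1) has a solution on $[0,T]$, and every solution $v$ of it on $[0,T]$ satisfies $$|u(ih,t)-v_i(t)|\le C\,(h^2+\varepsilon)\qquad\text{for all } t\in[0,T],\ -N\le i\le N.$$ -/

import Mathlib

open MeasureTheory TemperedDistribution Set
open scoped ContDiff SchwartzMap

noncomputable section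

/-! ### The Sobolev space `H^s(ℝ)` of real-valued functions -/

/-- A real-valued `L²` function on `ℝ`, regarded as a complex-valued one. -/
def complexify : Lp ℝ 2 (volume : Measure ℝ) →L[ℝ] Lp ℂ 2 (volume : Measure ℝ) :=
  Complex.ofRealCLM.compLpL 2 volume

theorem complexify_injective : Function.Injective complexify := by
  intro v w h
  apply Lp.ext
  have h1 := Complex.ofRealCLM.coeFn_compLpL (𝕜' := ℝ) (p := 2) (μ := volume) v
  have h2 := Complex.ofRealCLM.coeFn_compLpL (𝕜' := ℝ) (p := 2) (μ := volume) w
  have h3 : Complex.ofRealCLM.compLpL 2 volume v = Complex.ofRealCLM.compLpL 2 volume w := h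
  rw [h3] at h1
  filter_upwards [h1, h2] with x hx1 hx2
  have := hx1.symm.trans hx2
  simpa using this

/-- The real `L²` functions `w` with `(1 + |ξ|²)^{s/2} ŵ ∈ L²`, expressed through Mathlib's
Bessel potential spaces. For `s ≥ 0` these are exactly the real-valued elements of `H^s(ℝ)`. -/
def sobolevSubmodule (s : ℝ) : Submodule ℝ (Lp ℝ 2 (volume : Measure ℝ)) where
  carrier := {w | MemSobolev s 2 ((complexify w : Lp ℂ 2 (volume : Measure ℝ)) : 𝓢'(ℝ, ℂ))}
  add_mem' := by
    intro v w hv hw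
    have := MemSobolev.add hv hw
    rw [mem_ofPred_eq, map_add]
    rw [← Lp.toTemperedDistributionCLM_apply, ← Lp.toTemperedDistributionCLM_apply,
      ← map_add, Lp.toTemperedDistributionCLM_apply] at this
    exact this
  zero_mem' := by
    rw [mem_ofPred_eq, map_zero, ← Lp.toTemperedDistributionCLM_apply, map_zero]
    exact memSobolev_fun_zero ℝ ℂ s 2
  smul_mem' := by
    intro c w hw
    have := MemSobolev.smul (c : ℂ) hw
    rw [mem_ofPred_eq, map_smul]
    rw [← Lp.toTemperedDistributionCLM_apply, ← map_smul,
      Lp.toTemperedDistributionCLM_apply] at this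
    exact this

/-- `H^s(ℝ)`, real-valued (`s ≥ 0`). The norm is defined below; it is not the `L²` norm. -/
def SobolevH (s : ℝ) : Type := sobolevSubmodule s

namespace SobolevH

variable {s : ℝ}

instance : AddCommGroup (SobolevH s) := inferInstanceAs (AddCommGroup (sobolevSubmodule s))

instance : Module ℝ (SobolevH s) := inferInstanceAs (Module ℝ (sobolevSubmodule s))

/-- The underlying `L²` function. -/
def toL2 : SobolevH s →ₗ[ℝ] Lp ℝ 2 (volume : Measure ℝ) := (sobolevSubmodule s).subtype

theorem toL2_injective : Function.Injective (toL2 : SobolevH s → _) :=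
  Subtype.val_injective

theorem memSobolev (w : SobolevH s) :
    MemSobolev s 2 ((complexify (toL2 w) : Lp ℂ 2 (volume : Measure ℝ)) : 𝓢'(ℝ, ℂ)) := w.2

theorem Lp_toTemperedDistribution_injective {v w : Lp ℂ 2 (volume : Measure ℝ)}
    (h : (v : 𝓢'(ℝ, ℂ)) = (w : 𝓢'(ℝ, ℂ))) : v = w := by
  have := Lp.ker_toTemperedDistributionCLM_eq_bot (F := ℂ) (p := 2) (μ := (volume : Measure ℝ))
  have h' := LinearMap.ker_eq_bot.1 this
  exact h' h

/-- The `L²` function representing the Bessel potential `𝓕⁻¹ ((1 + |ξ|²)^{s/2} ŵ)`. -/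
def besselFun (w : SobolevH s) : Lp ℂ 2 (volume : Measure ℝ) := w.memSobolev.choose

theorem besselFun_spec (w : SobolevH s) :
    besselPotential ℝ ℂ s ((complexify (toL2 w) : Lp ℂ 2 (volume : Measure ℝ)) : 𝓢'(ℝ, ℂ))
      = (besselFun w : Lp ℂ 2 (volume : Measure ℝ)) :=
  w.memSobolev.choose_spec

/-- The Bessel potential as a linear map from `H^s(ℝ)` to `L²(ℝ)`. -/
def bessel : SobolevH s →ₗ[ℝ] Lp ℂ 2 (volume : Measure ℝ) where
  toFun := besselFun
  map_add' v w := by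
    apply Lp_toTemperedDistribution_injective
    rw [← besselFun_spec]
    have hv := besselFun_spec v
    have hw := besselFun_spec w
    simp only [← Lp.toTemperedDistributionCLM_apply, map_add] at hv hw ⊢
    rw [hv, hw]
  map_smul' c w := by
    apply Lp_toTemperedDistribution_injective
    rw [← besselFun_spec]
    have hw := besselFun_spec w
    have e : ∀ z : Lp ℂ 2 (volume : Measure ℝ), c • z = (c : ℂ) • z := fun z => rfl
    simp only [RingHom.id_apply, map_smul, e]
    simp only [← Lp.toTemperedDistributionCLM_apply, map_smul] at hw ⊢
    rw [hw]

theorem bessel_spec (w : SobolevH s) :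
    besselPotential ℝ ℂ s ((complexify (toL2 w) : Lp ℂ 2 (volume : Measure ℝ)) : 𝓢'(ℝ, ℂ))
      = (bessel w : Lp ℂ 2 (volume : Measure ℝ)) :=
  besselFun_spec w

theorem bessel_injective : Function.Injective (bessel : SobolevH s →ₗ[ℝ] _) := by
  intro v w h
  apply toL2_injective
  apply complexify_injective
  apply Lp_toTemperedDistribution_injective
  have hv := (besselPotential_neg_apply_eq_iff s _ _).2 (bessel_spec v)
  have hw := (besselPotential_neg_apply_eq_iff s _ _).2 (bessel_spec w)
  rw [← hv, ← hw, h]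

/-- The norm `‖w‖_{H^s} = ‖𝓕⁻¹ ((1 + |ξ|²)^{s/2} ŵ)‖_{L²} = ‖(1 + |ξ|²)^{s/2} ŵ‖_{L²}`, where
`ŵ(ξ) = ∫ w(x) e^{-2πixξ} dx`. -/
instance : NormedAddCommGroup (SobolevH s) :=
  NormedAddCommGroup.induced (SobolevH s) (Lp ℂ 2 (volume : Measure ℝ)) bessel bessel_injective

theorem norm_def (w : SobolevH s) : ‖w‖ = ‖bessel w‖ := rfl

instance : NormedSpace ℝ (SobolevH s) :=
  NormedSpace.induced ℝ (SobolevH s) (Lp ℂ 2 (volume : Measure ℝ)) bessel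

/-- The continuous function on `ℝ` that represents the class `w`. It exists for every
`w ∈ H^s(ℝ)` when `s > 1/2`, and a continuous representative is always unique. -/
def rep (w : SobolevH s) : ℝ → ℝ :=
  Classical.epsilon fun g : ℝ → ℝ => Continuous g ∧ g =ᵐ[volume] toL2 w

theorem rep_unique (w : SobolevH s) {g : ℝ → ℝ} (hg : Continuous g)
    (hgw : g =ᵐ[volume] toL2 w) : w.rep = g := by
  have h : Continuous w.rep ∧ w.rep =ᵐ[volume] toL2 w :=
    Classical.epsilon_spec (p := fun g : ℝ → ℝ => Continuous g ∧ g =ᵐ[volume] toL2 w)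
      ⟨g, hg, hgw⟩
  exact Continuous.ae_eq_iff_eq volume h.1 hg |>.1 (h.2.trans hgw.symm)

end SobolevH

/-! ### The kernel -/

/-- `g` is the weak (distributional) derivative of `w` on `ℝ`. -/
def HasWeakDeriv (w g : ℝ → ℝ) : Prop :=
  LocallyIntegrable w ∧ LocallyIntegrable g ∧
    ∀ ψ : ℝ → ℝ, ContDiff ℝ ∞ ψ → HasCompactSupport ψ →
      ∫ x, w x * deriv ψ x = -∫ x, g x * ψ x

/-- The integral `∫ g dμ` of a bounded measurable function against a finite signed measure. -/
def signedIntegral (μ : SignedMeasure ℝ) (g : ℝ → ℝ) : ℝ :=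
  (∫ x, g x ∂μ.toJordanDecomposition.posPart) - ∫ x, g x ∂μ.toJordanDecomposition.negPart

/-- The distributional derivative of `w` is the finite signed Borel measure `μ`. -/
def HasWeakDerivMeasure (w : ℝ → ℝ) (μ : SignedMeasure ℝ) : Prop :=
  LocallyIntegrable w ∧
    ∀ ψ : ℝ → ℝ, ContDiff ℝ ∞ ψ → HasCompactSupport ψ →
      ∫ x, w x * deriv ψ x = -signedIntegral μ ψ

/-- `α ∈ W^{2,1}(ℝ)` and `α''' = μ` is a finite (signed) Borel measure. The function `α'` is the
first weak derivative of `α`, taken as its continuous representative (an element of `W^{1,1}(ℝ)`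
has exactly one), so that its values at grid points are meaningful. -/
structure KernelConditions (α α' : ℝ → ℝ) (μ : SignedMeasure ℝ) : Prop where
  integrable : Integrable α
  weakDeriv : HasWeakDeriv α α'
  continuous_deriv : Continuous α'
  integrable_deriv : Integrable α'
  exists_second : ∃ α'' : ℝ → ℝ, HasWeakDeriv α' α'' ∧ Integrable α'' ∧ HasWeakDerivMeasure α'' μ

/-! ### The continuous Cauchy problem -/

/-- `u ∈ C¹([0,T], H^s(ℝ))` solves `u_t + α' * f(u) + κ α''' * u = 0` for `0 < t ≤ T`, `x ∈ ℝ`,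
with `u(0) = φ`; here `α''' = μ` is a measure. -/
structure IsCauchySolution (α' : ℝ → ℝ) (μ : SignedMeasure ℝ) (f : ℝ → ℝ) (κ T : ℝ) {s : ℝ}
    (φ : SobolevH s) (u : ℝ → SobolevH s) : Prop where
  contDiffOn : ContDiffOn ℝ 1 u (Icc 0 T)
  initial : u 0 = φ
  equation : ∀ t, 0 < t → t ≤ T → ∀ x : ℝ,
    (derivWithin u (Icc 0 T) t).rep x
      + (∫ y, α' (x - y) * f ((u t).rep y))
      + κ * signedIntegral μ (fun y => (u t).rep (x - y)) = 0

/-! ### The truncated semi-discrete problem -/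

/-- The restriction `(w(x_i))_i` of `w` to the grid `x_i = ih`, `i ∈ ℤ`. -/
def gridRestrict (h : ℝ) (w : ℝ → ℝ) : ℤ → ℝ := fun i => w (i * h)

/-- The second-order difference operator `D_h²` on doubly infinite sequences. -/
def secondDiff (h : ℝ) (w : ℤ → ℝ) : ℤ → ℝ :=
  fun i => (w (i + 1) - 2 * w i + w (i - 1)) / h ^ 2

/-- The indices `-N ≤ i ≤ N`. -/
abbrev TruncIdx (N : ℕ) : Type := Finset.Icc (-(N : ℤ)) (N : ℤ)

/-- The truncation operator `(v_i)_{i ∈ ℤ} ↦ (v_{-N}, …, v_N)`. -/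
def truncate (N : ℕ) (v : ℤ → ℝ) : TruncIdx N → ℝ := fun i => v i

/-- The right-hand side of the truncated system:
`-∑_{|j| ≤ N} h α'(x_i - x_j) f(v_j) - κ ∑_{|j| ≤ N} h D_h² α'(x_i - x_j) v_j`. -/
def truncRHS (α' f : ℝ → ℝ) (κ h : ℝ) (N : ℕ) (v : TruncIdx N → ℝ) : TruncIdx N → ℝ :=
  fun i =>
    -(∑ j : TruncIdx N, h * gridRestrict h α' ((i : ℤ) - (j : ℤ)) * f (v j))
      - κ * ∑ j : TruncIdx N,
          h * secondDiff h (gridRestrict h α') ((i : ℤ) - (j : ℤ)) * v j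

/-- `v` is a solution on `[0,T]` of the truncated system with initial value `v₀`. -/
structure IsTruncSolution (α' f : ℝ → ℝ) (κ h T : ℝ) (N : ℕ) (v₀ : TruncIdx N → ℝ)
    (v : ℝ → TruncIdx N → ℝ) : Prop where
  initial : v 0 = v₀
  equation : ∀ t ∈ Icc 0 T,
    HasDerivWithinAt v (truncRHS α' f κ h N (v t)) (Icc 0 T) t

end

/-! The scheme is consistent to second order because `α'''` is a finite measure. Pairing `α'` with a
tent (the Peano kernel of the second difference) gives `α'(x+z) - 2α'(x) + α'(x-z) = ∫ tent z (w -
x) dμ(w)` (`second_difference_eq`). Hence the discrete sum with `D_h² α'` is exactly the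
`μ`-integral of the piecewise linear interpolant of `u`. Its error is the interpolation error,
`O(h²)`, times the total variation of `μ` (`abs_signedIntegral_sub_sum_le`). For `α' * f(u)`,
interpolating `f(u)` costs `O(h²)‖α'‖₁`. Replacing tent averages of `α'` by samples costs one local
variation of `μ` per cell, and these are summable because the tents have bounded overlap
(`abs_convolution_sub_sum_le`). Dropping the nodes outside the truncated grid costs `O(δ)` once `|u|
≤ δ` there; continuity of `u` into `H^s` makes the decay uniform on `[0,T]`. The regularity needed,
`C^{1,1}` with uniform bounds, follows from integrability of `(1 + ξ²) û`. Stability comes from the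
same tent identity: the row sums of both matrices are bounded uniformly in `N` and in `h ≤ 1`, so
the vector field is Lipschitz in the sup norm on bounded sets. Clamping the values to `[-R, R]`
makes it globally Lipschitz and bounded, so a solution exists on `[0,T]`, and Gronwall bounds its
distance to `u` by `C(h² + δ)`. When this is at most 1 the clamp is inactive, so the solution solves
the original system, and uniqueness carries the bound to every solution. -/

noncomputable section

/-! ### Integration against a signed measure -/

/-- The total variation of a signed measure, as a measure. -/
def variationMeasure (μ : SignedMeasure ℝ) : Measure ℝ :=
  μ.toJordanDecomposition.posPart + μ.toJordanDecomposition.negPart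

instance (μ : SignedMeasure ℝ) : IsFiniteMeasure (variationMeasure μ) := by
  unfold variationMeasure; infer_instance

theorem integrable_posPart {μ : SignedMeasure ℝ} {g : ℝ → ℝ}
    (hg : Integrable g (variationMeasure μ)) :
    Integrable g μ.toJordanDecomposition.posPart :=
  hg.mono_measure (Measure.le_add_right le_rfl)

theorem integrable_negPart {μ : SignedMeasure ℝ} {g : ℝ → ℝ}
    (hg : Integrable g (variationMeasure μ)) :
    Integrable g μ.toJordanDecomposition.negPart :=
  hg.mono_measure (Measure.le_add_left le_rfl)

theorem abs_signedIntegral_le (μ : SignedMeasure ℝ) {g : ℝ → ℝ}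
    (hg : Integrable g (variationMeasure μ)) :
    |signedIntegral μ g| ≤ ∫ x, |g x| ∂variationMeasure μ := by
  have h1 := integrable_posPart hg
  have h2 := integrable_negPart hg
  rw [variationMeasure, integral_add_measure h1.abs h2.abs]
  exact (abs_sub _ _).trans
    (add_le_add (abs_integral_le_integral_abs) (abs_integral_le_integral_abs))

theorem abs_signedIntegral_le_of_le (μ : SignedMeasure ℝ) {g : ℝ → ℝ} {c : ℝ}
    (hg : Integrable g (variationMeasure μ)) (hc : ∀ x, |g x| ≤ c) :
    |signedIntegral μ g| ≤ c * (variationMeasure μ).real univ := by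
  refine (abs_signedIntegral_le μ hg).trans ?_
  calc ∫ x, |g x| ∂variationMeasure μ ≤ ∫ _, c ∂variationMeasure μ :=
        integral_mono hg.abs (integrable_const c) hc
    _ = _ := by simp [mul_comm]

theorem signedIntegral_sub (μ : SignedMeasure ℝ) {g k : ℝ → ℝ}
    (hg : Integrable g (variationMeasure μ)) (hk : Integrable k (variationMeasure μ)) :
    signedIntegral μ (fun x => g x - k x) = signedIntegral μ g - signedIntegral μ k := by
  unfold signedIntegral
  rw [integral_sub (integrable_posPart hg) (integrable_posPart hk),
    integral_sub (integrable_negPart hg) (integrable_negPart hk)]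
  ring

theorem signedIntegral_const_mul (μ : SignedMeasure ℝ) (c : ℝ) (g : ℝ → ℝ) :
    signedIntegral μ (fun x => c * g x) = c * signedIntegral μ g := by
  unfold signedIntegral
  rw [integral_const_mul, integral_const_mul]
  ring

theorem signedIntegral_sum (μ : SignedMeasure ℝ) {ι : Type*} (S : Finset ι) {g : ι → ℝ → ℝ}
    (hg : ∀ i ∈ S, Integrable (g i) (variationMeasure μ)) :
    signedIntegral μ (fun x => ∑ i ∈ S, g i x) = ∑ i ∈ S, signedIntegral μ (g i) := by
  unfold signedIntegral
  rw [integral_finsetSum _ fun i hi => integrable_posPart (hg i hi),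
    integral_finsetSum _ fun i hi => integrable_negPart (hg i hi), Finset.sum_sub_distrib]

theorem integrable_of_continuous_of_bound {ν : Measure ℝ} [IsFiniteMeasure ν] {g : ℝ → ℝ} {c : ℝ}
    (hg : Continuous g) (hc : ∀ x, |g x| ≤ c) : Integrable g ν :=
  Integrable.of_bound hg.aestronglyMeasurable c (Filter.Eventually.of_forall hc)

/-! ### The second difference of a function whose second weak derivative is a measure -/

/-- The tent function of height `z` with base `[-z, z]`. -/
def tent (z w : ℝ) : ℝ := max 0 (z - |w|)

theorem continuous_tent (z : ℝ) : Continuous (tent z) := by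
  unfold tent; fun_prop

theorem tent_nonneg (z w : ℝ) : 0 ≤ tent z w := le_max_left _ _

theorem tent_neg (z w : ℝ) : tent z (-w) = tent z w := by simp [tent]

theorem tent_le {z : ℝ} (hz : 0 ≤ z) (w : ℝ) : tent z w ≤ z :=
  max_le hz (by linarith [abs_nonneg w])

theorem abs_tent_le {z : ℝ} (hz : 0 ≤ z) (w : ℝ) : |tent z w| ≤ z := by
  rw [abs_of_nonneg (tent_nonneg z w)]
  exact tent_le hz w

theorem tent_eq_zero {z w : ℝ} (h : z ≤ |w|) : tent z w = 0 := max_eq_left (by linarith)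

theorem tent_mono {z z' : ℝ} (h : z ≤ z') (w : ℝ) : tent z w ≤ tent z' w :=
  max_le_max le_rfl (by linarith)

theorem hasCompactSupport_tent (z : ℝ) : HasCompactSupport (tent z) := by
  refine HasCompactSupport.intro (isCompact_Icc (a := -z) (b := z)) fun x hx => tent_eq_zero ?_
  by_contra h
  exact hx (abs_le.1 (not_le.1 h).le)

/-- The tent has second distributional derivative `δ_{-z} - 2δ_0 + δ_z`; concretely, integrate by
parts on each side of its apex. -/
theorem integral_mul_tent {g g' g'' : ℝ → ℝ} (hg : ∀ t, HasDerivAt g (g' t) t)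
    (hg' : ∀ t, HasDerivAt g' (g'' t) t) (hc : Continuous g'') {z : ℝ} (hz : 0 ≤ z) (y : ℝ) :
    ∫ t, g'' t * tent z (y - t) = g (y + z) - 2 * g y + g (y - z) := by
  have hsupp : Function.support (fun t => g'' t * tent z (y - t)) ⊆ Ioc (y - z) (y + z) := by
    intro t ht
    by_contra h
    apply ht
    have : tent z (y - t) = 0 := by
      apply tent_eq_zero
      rw [mem_Ioc, not_and_or] at h
      rcases h with h | h
      · exact le_trans (by linarith) (le_abs_self _)
      · exact le_trans (by linarith) (neg_le_abs _)
    simp [this]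
  have hint : ∀ a b, IntervalIntegrable (fun t => g'' t * tent z (y - t)) volume a b := fun a b =>
    (hc.mul ((continuous_tent z).comp (by fun_prop))).intervalIntegrable a b
  rw [← intervalIntegral.integral_eq_integral_of_support_subset hsupp,
    ← intervalIntegral.integral_add_adjacent_intervals (hint (y - z) y) (hint y (y + z))]
  -- Each half is put in product-rule form, the exact derivative of `g'` times an affine function,
  -- minus or plus `g`.
  have e1 : ∫ t in (y - z)..y, g'' t * tent z (y - t)
      = ∫ t in (y - z)..y, (g'' t * (z + t - y) + g' t * 1 - g' t) := by
    refine intervalIntegral.integral_congr fun t ht => ?_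
    rw [uIcc_of_le (by linarith)] at ht
    simp only [tent, abs_of_nonneg (by linarith [ht.2] : 0 ≤ y - t)]
    rw [max_eq_right (by linarith [ht.1])]
    ring
  have e2 : ∫ t in y..(y + z), g'' t * tent z (y - t)
      = ∫ t in y..(y + z), (g'' t * (z - t + y) + g' t * (-1) + g' t) := by
    refine intervalIntegral.integral_congr fun t ht => ?_
    rw [uIcc_of_le (by linarith)] at ht
    simp only [tent, abs_of_nonpos (by linarith [ht.1] : y - t ≤ 0)]
    rw [max_eq_right (by linarith [ht.2])]
    ring
  have hc' : Continuous g' := continuous_iff_continuousAt.2 fun t => (hg' t).continuousAt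
  rw [e1, e2, intervalIntegral.integral_eq_sub_of_hasDerivAt
      (f := fun t => g' t * (z + t - y) - g t),
    intervalIntegral.integral_eq_sub_of_hasDerivAt (f := fun t => g' t * (z - t + y) + g t)]
  · ring_nf
  · exact fun t _ => ((hg' t).mul (((hasDerivAt_id t).const_sub z).add_const y)).add (hg t)
  · exact Continuous.intervalIntegrable (by fun_prop) _ _
  · exact fun t _ => ((hg' t).mul (((hasDerivAt_id t).const_add z).sub_const y)).sub (hg t)
  · exact Continuous.intervalIntegrable (by fun_prop) _ _

namespace KernelConditions

variable {α α' : ℝ → ℝ} {μ : SignedMeasure ℝ}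

theorem integral_mul_deriv_deriv (hα : KernelConditions α α' μ) {ψ : ℝ → ℝ}
    (hψ : ContDiff ℝ ∞ ψ) (hψc : HasCompactSupport ψ) :
    ∫ x, α' x * deriv (deriv ψ) x = signedIntegral μ ψ := by
  obtain ⟨α'', h1, -, h2⟩ := hα.exists_second
  have hd : ContDiff ℝ ∞ (deriv ψ) := (contDiff_infty_iff_deriv.1 hψ).2
  rw [h1.2.2 _ hd hψc.deriv, h2.2 _ hψ hψc, neg_neg]

open scoped Convolution

/-- The tent is not an admissible test function, but its mollification is. The second derivative of
the latter is a second difference of `ρ`, and evenness of `ρ` lets the mollifier be transferred to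
`α'`. -/
theorem second_difference_smooth (hα : KernelConditions α α' μ) {ρ : ℝ → ℝ}
    (hρ : ContDiff ℝ ∞ ρ) (hρc : HasCompactSupport ρ) (hρn : ∀ t, ρ (-t) = ρ t)
    (x : ℝ) {z : ℝ} (hz : 0 ≤ z) :
    (ρ ⋆[ContinuousLinearMap.lsmul ℝ ℝ] α') (x + z)
      - 2 * (ρ ⋆[ContinuousLinearMap.lsmul ℝ ℝ] α') x
      + (ρ ⋆[ContinuousLinearMap.lsmul ℝ ℝ] α') (x - z)
    = signedIntegral μ (ρ ⋆[ContinuousLinearMap.lsmul ℝ ℝ] fun w => tent z (w - x)) := by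
  set τ : ℝ → ℝ := fun w => tent z (w - x) with hτ
  have hτc : Continuous τ := (continuous_tent z).comp (by fun_prop)
  have hτs : HasCompactSupport τ := (hasCompactSupport_tent z).comp_homeomorph (Homeomorph.subRight x)
  have hτl : LocallyIntegrable τ := hτc.locallyIntegrable
  have hρ' : ContDiff ℝ ∞ (deriv ρ) := (contDiff_infty_iff_deriv.1 hρ).2
  have hρ'' : ContDiff ℝ ∞ (deriv (deriv ρ)) := (contDiff_infty_iff_deriv.1 hρ').2
  have hd : deriv (deriv (ρ ⋆[ContinuousLinearMap.lsmul ℝ ℝ] τ))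
      = fun y => ρ (y - x + z) - 2 * ρ (y - x) + ρ (y - x - z) := by
    have e1 : deriv (ρ ⋆[ContinuousLinearMap.lsmul ℝ ℝ] τ)
        = (deriv ρ ⋆[ContinuousLinearMap.lsmul ℝ ℝ] τ) := funext fun y =>
      (hρc.hasDerivAt_convolution_left _ (hρ.of_le (by simp)) hτl y).deriv
    rw [e1]
    funext y
    rw [(hρc.deriv.hasDerivAt_convolution_left _ (hρ'.of_le (by simp)) hτl y).deriv,
      ← integral_mul_tent (fun t => (hρ.differentiable (by simp) t).hasDerivAt)
        (fun t => (hρ'.differentiable (by simp) t).hasDerivAt) hρ''.continuous hz (y - x)]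
    unfold convolution
    refine integral_congr_ae (Filter.Eventually.of_forall fun t => ?_)
    simp only [hτ, ContinuousLinearMap.lsmul_apply, smul_eq_mul]
    ring_nf
  have hsm : ContDiff ℝ ∞ (ρ ⋆[ContinuousLinearMap.lsmul ℝ ℝ] τ) :=
    hρc.contDiff_convolution_left _ hρ hτl
  rw [← hα.integral_mul_deriv_deriv hsm (hρc.convolution _ hτs), hd]
  have key : ∀ b, (ρ ⋆[ContinuousLinearMap.lsmul ℝ ℝ] α') b = ∫ y, α' y * ρ (y - b) := by
    intro b
    unfold convolution
    rw [← integral_sub_left_eq_self _ _ b]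
    refine integral_congr_ae (Filter.Eventually.of_forall fun t => ?_)
    simp only [ContinuousLinearMap.lsmul_apply, smul_eq_mul, sub_sub_cancel]
    rw [← hρn (b - t), neg_sub, mul_comm]
  have hi : ∀ b, Integrable fun y => α' y * ρ (y - b) := fun b =>
    (hα.continuous_deriv.mul (hρ.continuous.comp (by fun_prop))).integrable_of_hasCompactSupport
      ((hρc.comp_homeomorph (Homeomorph.subRight b)).mul_left)
  have hi' : Integrable fun y => α' y * ρ (y - (x + z)) - 2 * (α' y * ρ (y - x)) :=
    (hi _).sub ((hi _).const_mul _)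
  rw [key, key, key, ← integral_const_mul, ← integral_sub (hi _) ((hi _).const_mul _),
    ← integral_add hi' (hi _)]
  refine integral_congr_ae (Filter.Eventually.of_forall fun t => ?_)
  simp only [show t - x + z = t - (x - z) by ring, show t - x - z = t - (x + z) by ring]
  ring

/-- Shrink the mollifier: the left side converges since `α'` is continuous, the right side by
dominated convergence, the mollified tents being bounded by `z` and `μ` finite. -/
theorem second_difference_eq (hα : KernelConditions α α' μ) (x : ℝ) {z : ℝ} (hz : 0 ≤ z) :
    α' (x + z) - 2 * α' x + α' (x - z) = signedIntegral μ (fun w => tent z (w - x)) := by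
  let φ : ℕ → ContDiffBump (0 : ℝ) := fun n =>
    ⟨1 / ((n : ℝ) + 1) / 2, 1 / ((n : ℝ) + 1), by positivity, half_lt_self (by positivity)⟩
  have hφ : Filter.Tendsto (fun n => (φ n).rOut) Filter.atTop (nhds 0) :=
    tendsto_one_div_add_atTop_nhds_zero_nat
  set τ : ℝ → ℝ := fun w => tent z (w - x) with hτ
  have hτc : Continuous τ := (continuous_tent z).comp (by fun_prop)
  have h1 : ∀ b, Filter.Tendsto
      (fun n => ((φ n).normed volume ⋆[ContinuousLinearMap.lsmul ℝ ℝ] α') b) Filter.atTop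
      (nhds (α' b)) := fun b =>
    ContDiffBump.convolution_tendsto_right_of_continuous hφ hα.continuous_deriv b
  have hcont : ∀ n, Continuous ((φ n).normed volume ⋆[ContinuousLinearMap.lsmul ℝ ℝ] τ) := fun n =>
    ((φ n).hasCompactSupport_normed.contDiff_convolution_left (n := 0) _
      ((φ n).contDiff_normed) hτc.locallyIntegrable).continuous
  have hbd : ∀ n y, ‖((φ n).normed volume ⋆[ContinuousLinearMap.lsmul ℝ ℝ] τ) y‖ ≤ z := by
    intro n y
    unfold convolution
    calc _ ≤ ∫ t, (φ n).normed volume t * z := by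
          refine norm_integral_le_of_norm_le ((φ n).integrable_normed.mul_const z)
            (Filter.Eventually.of_forall fun t => ?_)
          rw [ContinuousLinearMap.lsmul_apply, norm_smul, Real.norm_eq_abs,
            abs_of_nonneg ((φ n).nonneg_normed t)]
          exact mul_le_mul_of_nonneg_left (abs_tent_le hz _) ((φ n).nonneg_normed t)
      _ = z := by rw [integral_mul_const, (φ n).integral_normed, one_mul]
  have h2 : Filter.Tendsto
      (fun n => signedIntegral μ ((φ n).normed volume ⋆[ContinuousLinearMap.lsmul ℝ ℝ] τ))
      Filter.atTop (nhds (signedIntegral μ τ)) := by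
    have aux : ∀ ν : Measure ℝ, IsFiniteMeasure ν → Filter.Tendsto
        (fun n => ∫ y, ((φ n).normed volume ⋆[ContinuousLinearMap.lsmul ℝ ℝ] τ) y ∂ν)
        Filter.atTop (nhds (∫ y, τ y ∂ν)) := fun ν _ =>
      tendsto_integral_of_dominated_convergence (fun _ => z)
        (fun n => (hcont n).aestronglyMeasurable) (integrable_const z)
        (fun n => Filter.Eventually.of_forall (hbd n))
        (Filter.Eventually.of_forall fun y =>
          ContDiffBump.convolution_tendsto_right_of_continuous hφ hτc y)
    exact (aux _ inferInstance).sub (aux _ inferInstance)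
  refine tendsto_nhds_unique (((h1 (x + z)).sub ((h1 x).const_mul 2)).add (h1 (x - z))) ?_
  refine h2.congr fun n => ?_
  exact (hα.second_difference_smooth (φ n).contDiff_normed (φ n).hasCompactSupport_normed
    (fun t => (φ n).normed_neg t) x hz).symm

end KernelConditions

/-! ### The Sobolev embedding -/

open scoped FourierTransform

theorem memLp_bessel_weight {r : ℝ} (hr : 1 < 2 * r) :
    MemLp (fun ξ : ℝ => (((1 + ‖ξ‖ ^ 2) ^ (-r / 2) : ℝ) : ℂ)) 2 volume := by
  suffices h : MemLp (fun ξ : ℝ => (1 + ‖ξ‖ ^ 2) ^ (-r / 2)) 2 volume from h.ofReal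
  have hc : Continuous fun ξ : ℝ => (1 + ‖ξ‖ ^ 2) ^ (-r / 2) :=
    (by fun_prop : Continuous fun ξ : ℝ => 1 + ‖ξ‖ ^ 2).rpow_const
      fun ξ => Or.inl (by positivity)
  rw [memLp_two_iff_integrable_sq hc.aestronglyMeasurable]
  refine (integrable_rpow_neg_one_add_norm_sq (E := ℝ) (μ := volume) (r := 2 * r)
    (by simpa using hr)).congr (Filter.Eventually.of_forall fun ξ => ?_)
  dsimp only
  rw [← Real.rpow_natCast ((1 + ‖ξ‖ ^ 2) ^ (-r / 2)) 2, ← Real.rpow_mul (by positivity)]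
  congr 1
  push_cast
  ring

theorem norm_fourier_le (ρ : ℝ → ℂ) (x : ℝ) : ‖𝓕 ρ x‖ ≤ ∫ ξ, ‖ρ ξ‖ :=
  VectorFourier.norm_fourierIntegral_le_integral_norm _ _ _ _ _

theorem integral_fourier_mul_eq {ψ ρ : ℝ → ℂ} (hψ : Integrable ψ) (hρ : Integrable ρ) :
    ∫ ξ, 𝓕 ψ ξ * ρ ξ = ∫ x, ψ x * 𝓕 ρ x := by
  simpa using! VectorFourier.integral_fourierIntegral_smul_eq_flip (L := innerₗ ℝ)
      Real.continuous_fourierChar continuous_inner hψ hρ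

/-- An `L²` function whose distributional Fourier transform is an integrable function agrees almost
everywhere with the inverse Fourier integral of that function. -/
theorem ae_eq_fourierInv_of_integral_eq {w : Lp ℂ 2 (volume : Measure ℝ)} {ρ : ℝ → ℂ}
    (hρ : Integrable ρ) (h : ∀ ψ : 𝓢(ℝ, ℂ), ∫ x, ψ x * w x = ∫ ξ, (𝓕⁻ ψ) ξ * ρ ξ) :
    w =ᵐ[volume] 𝓕⁻ ρ := by
  have hρ' : Integrable fun ξ => ρ (-ξ) := hρ.comp_neg
  have hcont : Continuous (𝓕⁻ ρ) := by
    rw [Real.fourierInv_eq_fourier_comp_neg]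
    exact VectorFourier.fourierIntegral_continuous Real.continuous_fourierChar continuous_inner hρ'
  refine ae_eq_of_integral_contDiff_smul_eq ((Lp.memLp w).locallyIntegrable (by norm_num))
    hcont.locallyIntegrable fun g hg hgc => ?_
  have hg₁ : HasCompactSupport (Complex.ofRealCLM ∘ g) := hgc.comp_left rfl
  have hg₂ : ContDiff ℝ ∞ (Complex.ofRealCLM ∘ g) := by fun_prop
  set ψ : 𝓢(ℝ, ℂ) := hg₁.toSchwartzMap hg₂
  have hψ : ∀ x, ψ x = (g x : ℂ) := fun x => rfl
  have e := h ψ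
  -- Reflecting `ξ` turns `𝓕⁻ ψ` into `𝓕 ψ`, so that the transform can be moved onto `ρ`.
  rw [← integral_neg_eq_self (fun ξ => (𝓕⁻ ψ : 𝓢(ℝ, ℂ)) ξ * ρ ξ) volume] at e
  have e2 : ∀ ξ, (𝓕⁻ ψ : 𝓢(ℝ, ℂ)) (-ξ) = 𝓕 (ψ : ℝ → ℂ) ξ := fun ξ => by
    rw [SchwartzMap.fourierInv_coe, Real.fourierInv_eq_fourier_neg, neg_neg]
  simp only [e2] at e
  rw [integral_fourier_mul_eq ψ.integrable hρ', ← Real.fourierInv_eq_fourier_comp_neg] at e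
  simpa [hψ] using e

namespace SobolevH

variable {s : ℝ}

/-- The Fourier transform of an element of `H^s(ℝ)`, as a function. -/
def fourierDensity (w : SobolevH s) (ξ : ℝ) : ℂ :=
  (((1 + ‖ξ‖ ^ 2) ^ (-s / 2) : ℝ) : ℂ) * (𝓕 (bessel w) : Lp ℂ 2 (volume : Measure ℝ)) ξ

/-- Inverting the Bessel potential exhibits `w` as a Fourier multiplier applied to an `L²` function;
by duality the multiplier and the inverse transform fall on `ψ`. -/
theorem integral_schwartz_mul_eq (w : SobolevH s) (ψ : 𝓢(ℝ, ℂ)) :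
    ∫ x, ψ x * (complexify (toL2 w) : Lp ℂ 2 (volume : Measure ℝ)) x
      = ∫ ξ, (𝓕⁻ ψ) ξ * fourierDensity w ξ := by
  set W : 𝓢'(ℝ, ℂ) := ((complexify (toL2 w) : Lp ℂ 2 (volume : Measure ℝ)) : 𝓢'(ℝ, ℂ)) with hW
  have h1 : besselPotential ℝ ℂ (-s) ((bessel w : Lp ℂ 2 (volume : Measure ℝ)) : 𝓢'(ℝ, ℂ)) = W :=
    (besselPotential_neg_apply_eq_iff s _ _).2 (bessel_spec w)
  have h2 : W ψ = ∫ x, ψ x * (complexify (toL2 w) : Lp ℂ 2 (volume : Measure ℝ)) x := by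
    rw [hW, Lp.toTemperedDistribution_apply]
    rfl
  rw [← h2, ← h1, besselPotential, fourierMultiplierCLM_apply, fourierInv_apply,
    smulLeftCLM_apply_apply, Lp.fourier_toTemperedDistribution_eq, Lp.toTemperedDistribution_apply]
  refine integral_congr_ae (Filter.Eventually.of_forall fun ξ => ?_)
  dsimp only
  rw [SchwartzMap.smulLeftCLM_apply_apply (by fun_prop), fourierDensity, smul_eq_mul, smul_eq_mul]
  ring

/-- Cauchy–Schwarz: the integrand is `(1 + ξ²)^{-(s-2)/2}` times an `L²` function of norm `‖w‖`. The
weight is square integrable because `s - 2 > 1/2`, which is the origin of the threshold `5/2`. -/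
theorem exists_integral_norm_fourierDensity_le (hs : 5 / 2 < s) :
    ∃ C : ℝ, 0 ≤ C ∧ ∀ w : SobolevH s,
      Integrable (fun ξ : ℝ => ((1 + ξ ^ 2 : ℝ) : ℂ) * fourierDensity w ξ) ∧
      ∫ ξ : ℝ, ‖((1 + ξ ^ 2 : ℝ) : ℂ) * fourierDensity w ξ‖ ≤ C * ‖w‖ := by
  have hm := memLp_bessel_weight (r := s - 2) (by linarith)
  refine ⟨‖hm.toLp _‖, norm_nonneg _, fun w => ?_⟩
  set γ : Lp ℂ 2 (volume : Measure ℝ) := 𝓕 (bessel w) with hγ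
  set p : Lp ℂ 1 (volume : Measure ℝ) := hm.toLp _ • γ with hp
  have hae : p =ᵐ[volume] fun ξ : ℝ => ((1 + ξ ^ 2 : ℝ) : ℂ) * fourierDensity w ξ := by
    filter_upwards [Lp.coeFn_lpSMul (r := 1) (hm.toLp _) γ, hm.coeFn_toLp] with ξ h1 h2
    rw [hp, h1, Pi.smul_apply', h2, smul_eq_mul, fourierDensity, ← mul_assoc, ← Complex.ofReal_mul]
    congr 2
    rw [Real.norm_eq_abs, sq_abs]
    nth_rewrite 2 [← Real.rpow_one (1 + ξ ^ 2)]
    rw [← Real.rpow_add (by positivity)]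
    congr 1
    ring
  refine ⟨(L1.integrable_coeFn p).congr hae, ?_⟩
  calc ∫ ξ : ℝ, ‖((1 + ξ ^ 2 : ℝ) : ℂ) * fourierDensity w ξ‖ = ‖p‖ := by
        rw [L1.norm_eq_integral_norm]
        exact integral_congr_ae (hae.symm.fun_comp norm)
    _ ≤ ‖hm.toLp _‖ * ‖γ‖ := Lp.norm_smul_le _ _
    _ = ‖hm.toLp _‖ * ‖w‖ := by rw [hγ, Lp.norm_fourier_eq, norm_def]

/-- A Fourier integral with integrable second moment is differentiable, with Lipschitz derivative,
and all bounds are in terms of the moment. -/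
theorem fourier_regularity {ρ : ℝ → ℂ} {K : ℝ} (hm : AEStronglyMeasurable ρ)
    (hi : Integrable fun ξ : ℝ => ((1 + ξ ^ 2 : ℝ) : ℂ) * ρ ξ)
    (hK : ∫ ξ : ℝ, ‖((1 + ξ ^ 2 : ℝ) : ℂ) * ρ ξ‖ ≤ K) :
    Integrable ρ ∧ ∃ G' : ℝ → ℂ, (∀ x, HasDerivAt (𝓕 ρ) (G' x) x) ∧ (∀ x, ‖𝓕 ρ x‖ ≤ K) ∧
      (∀ x, ‖G' x‖ ≤ 2 * Real.pi * K) ∧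
      ∀ x y, ‖G' x - G' y‖ ≤ (2 * Real.pi) ^ 2 * K * |x - y| := by
  have hn : ∀ ξ : ℝ, ‖((1 + ξ ^ 2 : ℝ) : ℂ) * ρ ξ‖ = (1 + ξ ^ 2) * ‖ρ ξ‖ := fun ξ => by
    rw [norm_mul, Complex.norm_real, Real.norm_eq_abs, abs_of_nonneg (by positivity)]
  -- Used for the weights `1`, `ξ` and `ξ²`, which control the function and its first two
  -- derivatives.
  have dom : ∀ {a : ℝ → ℂ}, Continuous a → (∀ ξ, ‖a ξ‖ ≤ 1 + ξ ^ 2) →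
      Integrable (fun ξ => a ξ * ρ ξ) ∧ ∫ ξ, ‖a ξ * ρ ξ‖ ≤ K := by
    intro a ha hb
    have hle : ∀ ξ, ‖a ξ * ρ ξ‖ ≤ ‖((1 + ξ ^ 2 : ℝ) : ℂ) * ρ ξ‖ := fun ξ => by
      rw [hn, norm_mul]
      exact mul_le_mul_of_nonneg_right (hb ξ) (norm_nonneg _)
    have h1 : Integrable (fun ξ => a ξ * ρ ξ) :=
      hi.mono (ha.aestronglyMeasurable.mul hm) (Filter.Eventually.of_forall hle)
    exact ⟨h1, (integral_mono h1.norm hi.norm hle).trans hK⟩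
  have hx : ∀ ξ : ℝ, |ξ| ≤ 1 + ξ ^ 2 := fun ξ => by
    rw [← sq_abs ξ]; nlinarith [sq_nonneg (|ξ| - 1), abs_nonneg ξ]
  have d0 := dom (a := fun _ => 1) continuous_const fun ξ => by
    rw [norm_one]; nlinarith [sq_nonneg ξ]
  have d1 := dom (a := fun ξ => (ξ : ℂ)) Complex.continuous_ofReal fun ξ => by
    rw [Complex.norm_real]; exact hx ξ
  have d2 := dom (a := fun ξ => (ξ : ℂ) * ξ) (by fun_prop) fun ξ => by
    rw [norm_mul, Complex.norm_real, Real.norm_eq_abs, abs_mul_abs_self]; nlinarith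
  simp only [one_mul] at d0
  set c : ℂ := -2 * Real.pi * Complex.I with hc
  have hcn : ‖c‖ = 2 * Real.pi := by simp [hc, abs_of_pos Real.pi_pos]
  set ρ₁ : ℝ → ℂ := fun ξ => (-2 * Real.pi * Complex.I * ξ) • ρ ξ with hρ₁
  set ρ₂ : ℝ → ℂ := fun ξ => (-2 * Real.pi * Complex.I * ξ) • ρ₁ ξ with hρ₂
  have e1 : ρ₁ = fun ξ => c * (ξ * ρ ξ) := by
    funext ξ; simp only [hρ₁, smul_eq_mul, hc]; ring
  have e2 : ρ₂ = fun ξ => c ^ 2 * (ξ * ξ * ρ ξ) := by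
    funext ξ; simp only [hρ₂, hρ₁, smul_eq_mul, hc]; ring
  have D1 : ∀ x, HasDerivAt (𝓕 ρ) (𝓕 ρ₁ x) x :=
    Real.hasDerivAt_fourier d0.1 (by simpa using d1.1)
  have D2 : ∀ x, HasDerivAt (𝓕 ρ₁) (𝓕 ρ₂ x) x := by
    refine Real.hasDerivAt_fourier (by rw [e1]; exact d1.1.const_mul c) ?_
    refine (d2.1.const_mul c).congr (Filter.Eventually.of_forall fun ξ => ?_)
    simp only [e1, Complex.real_smul]
    ring
  refine ⟨d0.1, 𝓕 ρ₁, D1, fun x => (norm_fourier_le ρ x).trans d0.2, fun x => ?_, fun x y => ?_⟩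
  · refine (norm_fourier_le ρ₁ x).trans ?_
    simp only [e1, norm_mul c, hcn]
    rw [integral_const_mul]
    exact mul_le_mul_of_nonneg_left d1.2 (by positivity)
  · refine Convex.norm_image_sub_le_of_norm_hasDerivWithin_le (s := univ)
      (fun x _ => (D2 x).hasDerivWithinAt) (fun x _ => ?_) convex_univ (mem_univ y) (mem_univ x)
    refine (norm_fourier_le ρ₂ x).trans ?_
    simp only [e2, norm_mul (c ^ 2), norm_pow, hcn]
    rw [integral_const_mul]
    exact mul_le_mul_of_nonneg_left d2.2 (by positivity)

/-- The Sobolev embedding `H^s(ℝ) ⊆ C^{1,1}(ℝ)` for `s > 5/2`; all functions vanish at infinity. -/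
theorem exists_embedding_const (hs : 5 / 2 < s) :
    ∃ C : ℝ, 0 ≤ C ∧ ∀ w : SobolevH s, w.rep =ᵐ[volume] toL2 w ∧
      Filter.Tendsto w.rep (Filter.cocompact ℝ) (nhds 0) ∧ (∀ x, |w.rep x| ≤ C * ‖w‖) ∧
      ∃ g' : ℝ → ℝ, (∀ x, HasDerivAt w.rep (g' x) x) ∧ (∀ x, |g' x| ≤ C * ‖w‖) ∧
        ∀ x y, |g' x - g' y| ≤ C * ‖w‖ * |x - y| := by
  obtain ⟨C, hC, hw⟩ := exists_integral_norm_fourierDensity_le hs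
  have hpi := Real.two_le_pi
  -- The largest of the factors `1`, `2π`, `(2π)²` belonging to the three bounds.
  refine ⟨(2 * Real.pi) ^ 2 * C, by positivity, fun w => ?_⟩
  obtain ⟨hi, hK⟩ := hw w
  have hCw : 0 ≤ C * ‖w‖ := by positivity
  -- After reflection the inverse transform of the density is a forward one, as `fourier_regularity`
  -- expects.
  set ρ : ℝ → ℂ := fun ξ => fourierDensity w (-ξ) with hρ
  have hi' : Integrable fun ξ : ℝ => ((1 + ξ ^ 2 : ℝ) : ℂ) * ρ ξ := by
    refine hi.comp_neg.congr (Filter.Eventually.of_forall fun ξ => ?_)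
    simp [hρ]
  have hK' : ∫ ξ : ℝ, ‖((1 + ξ ^ 2 : ℝ) : ℂ) * ρ ξ‖ ≤ C * ‖w‖ := by
    rw [← integral_neg_eq_self] at hK
    simpa [hρ] using hK
  have hmeas : AEStronglyMeasurable (fourierDensity w) := by
    unfold fourierDensity
    refine AEStronglyMeasurable.mul (memLp_bessel_weight (r := s) (by linarith)).1
      (Lp.aestronglyMeasurable _)
  have hmeas' : AEStronglyMeasurable ρ :=
    hmeas.comp_measurePreserving (Measure.measurePreserving_neg volume)
  obtain ⟨hρi, G', h1, h2, h3, h4⟩ := fourier_regularity hmeas' hi' hK'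
  have hdi : Integrable (fourierDensity w) := by simpa [hρ] using hρi.comp_neg
  have hae := ae_eq_fourierInv_of_integral_eq hdi (integral_schwartz_mul_eq w)
  rw [Real.fourierInv_eq_fourier_comp_neg] at hae
  have hgc : Continuous fun x => (𝓕 ρ x).re :=
    Complex.continuous_re.comp (continuous_iff_continuousAt.2 fun x => (h1 x).continuousAt)
  have hga : (fun x => (𝓕 ρ x).re) =ᵐ[volume] toL2 w := by
    filter_upwards [hae, Complex.ofRealCLM.coeFn_compLpL (𝕜' := ℝ) (p := 2) (μ := volume) (toL2 w)]
      with x hx1 hx2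
    have hx3 : (complexify (toL2 w) : Lp ℂ 2 (volume : Measure ℝ)) x = ((toL2 w x : ℝ) : ℂ) := hx2
    rw [← hx1, hx3, Complex.ofReal_re]
  have hrep := rep_unique w hgc hga
  have hpi2 : 2 * Real.pi ≤ (2 * Real.pi) ^ 2 := by nlinarith
  have hpi1 : 1 ≤ (2 * Real.pi) ^ 2 := by nlinarith
  rw [hrep]
  refine ⟨hga, ?_, fun x => ?_, fun x => (G' x).re, fun x => ?_, fun x => ?_, fun x y => ?_⟩
  · have := (Complex.continuous_re.tendsto 0).comp (Real.zero_at_infty_fourier ρ)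
    simpa using! this
  · refine (Complex.abs_re_le_norm _).trans ((h2 x).trans ?_)
    nlinarith
  · exact Complex.reCLM.hasFDerivAt.comp_hasDerivAt x (h1 x)
  · refine (Complex.abs_re_le_norm _).trans ((h3 x).trans ?_)
    nlinarith
  · rw [← Complex.sub_re]
    refine (Complex.abs_re_le_norm _).trans ((h4 x y).trans ?_)
    rw [mul_assoc ((2 * Real.pi) ^ 2) C]

theorem continuous_rep (hs : 5 / 2 < s) (w : SobolevH s) : Continuous w.rep := by
  obtain ⟨C, -, h⟩ := exists_embedding_const hs
  obtain ⟨-, -, -, g', hg', -⟩ := h w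
  exact continuous_iff_continuousAt.2 fun x => (hg' x).continuousAt

theorem rep_ae_eq (hs : 5 / 2 < s) (w : SobolevH s) : w.rep =ᵐ[volume] toL2 w := by
  obtain ⟨C, -, h⟩ := exists_embedding_const hs
  exact (h w).1

theorem rep_add (hs : 5 / 2 < s) (v w : SobolevH s) : (v + w).rep = v.rep + w.rep := by
  refine rep_unique _ ((continuous_rep hs v).add (continuous_rep hs w)) ?_
  rw [map_add]
  exact ((rep_ae_eq hs v).add (rep_ae_eq hs w)).trans (Lp.coeFn_add _ _).symm

theorem rep_smul (hs : 5 / 2 < s) (c : ℝ) (w : SobolevH s) : (c • w).rep = c • w.rep := by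
  refine rep_unique _ ((continuous_rep hs w).const_smul c) ?_
  rw [map_smul]
  exact ((rep_ae_eq hs w).const_smul c).trans (Lp.coeFn_smul _ _).symm

/-- Evaluation of the continuous representative at a point, as a continuous linear functional. -/
theorem exists_eval (hs : 5 / 2 < s) (x : ℝ) :
    ∃ L : SobolevH s →L[ℝ] ℝ, ∀ w, L w = w.rep x := by
  obtain ⟨C, -, h⟩ := exists_embedding_const hs
  exact ⟨LinearMap.mkContinuous
    { toFun := fun w => w.rep x
      map_add' := fun v w => by rw [rep_add hs]; rfl
      map_smul' := fun c w => by rw [rep_smul hs]; rfl } C fun w => (h w).2.2.1 x, fun _ => rfl⟩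

end SobolevH

/-! ### Piecewise linear interpolation on the grid -/

theorem tent_grid_eq {h : ℝ} (hh : 0 < h) (n j : ℤ) {θ : ℝ} (h0 : 0 ≤ θ) (h1 : θ < 1) :
    tent h (h * (n + θ) - j * h)
      = h * ((if j = n then 1 - θ else 0) + if j = n + 1 then θ else 0) := by
  have e : h * ((n : ℝ) + θ) - j * h = h * (((n - j : ℤ) : ℝ) + θ) := by push_cast; ring
  rw [e]
  rcases lt_trichotomy j n with hj | hj | hj
  · have : (1 : ℝ) ≤ ((n - j : ℤ) : ℝ) := by exact_mod_cast (by lia : 1 ≤ n - j)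
    rw [tent_eq_zero, if_neg hj.ne, if_neg (by lia)]
    · simp
    · exact le_trans (by nlinarith) (le_abs_self _)
  · subst hj
    rw [if_pos rfl, if_neg (by lia)]
    simp only [sub_self, Int.cast_zero, zero_add, add_zero, tent]
    rw [abs_of_nonneg (by positivity), max_eq_right (by nlinarith)]
    ring
  · rcases eq_or_lt_of_le (by lia : n + 1 ≤ j) with hj' | hj'
    · subst hj'
      rw [if_neg (by lia), if_pos rfl, tent]
      have : ((n - (n + 1) : ℤ) : ℝ) = -1 := by push_cast; ring
      rw [this, abs_of_nonpos (by nlinarith), max_eq_right (by nlinarith)]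
      ring
    · have : ((n - j : ℤ) : ℝ) ≤ -2 := by exact_mod_cast (by lia : n - j ≤ -2)
      rw [tent_eq_zero, if_neg hj.ne', if_neg hj'.ne']
      · simp
      · exact le_trans (by nlinarith) (neg_le_abs _)

theorem sum_mul_tent_grid {h : ℝ} (hh : 0 < h) (S : Finset ℤ) (c : ℤ → ℝ) (n : ℤ) {θ : ℝ}
    (h0 : 0 ≤ θ) (h1 : θ < 1) :
    ∑ j ∈ S, c j * tent h (h * (n + θ) - j * h)
      = h * ((if n ∈ S then c n else 0) * (1 - θ) + (if n + 1 ∈ S then c (n + 1) else 0) * θ) := by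
  have e : ∀ j : ℤ, c j * tent h (h * (n + θ) - j * h)
      = (if j = n then h * (c j * (1 - θ)) else 0) + if j = n + 1 then h * (c j * θ) else 0 := by
    intro j
    rw [tent_grid_eq hh n j h0 h1]
    split_ifs <;> ring
  simp only [e, Finset.sum_add_distrib, Finset.sum_ite_eq']
  split_ifs <;> ring

theorem exists_grid_cell {h : ℝ} (hh : 0 < h) (y : ℝ) :
    ∃ (n : ℤ) (θ : ℝ), 0 ≤ θ ∧ θ < 1 ∧ y = h * (n + θ) := by
  refine ⟨⌊y / h⌋, Int.fract (y / h), Int.fract_nonneg _, Int.fract_lt_one _, ?_⟩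
  rw [Int.floor_add_fract]
  field_simp

/-- The tents over the whole grid are `h` times a partition of unity, and restricting to `S` only
drops nonnegative terms. -/
theorem sum_tent_grid_le {h : ℝ} (hh : 0 < h) (S : Finset ℤ) (y : ℝ) :
    ∑ j ∈ S, tent h (y - j * h) ≤ h := by
  obtain ⟨n, θ, h0, h1, rfl⟩ := exists_grid_cell hh y
  have := sum_mul_tent_grid hh S (fun _ => 1) n h0 h1
  simp only [one_mul] at this
  rw [this]
  have : (if n ∈ S then (1 : ℝ) else 0) * (1 - θ) + (if n + 1 ∈ S then (1 : ℝ) else 0) * θ ≤ 1 := by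
    split_ifs <;> linarith
  nlinarith

/-- Mean value inequality for `t ↦ g t - g' y * t`, whose derivative is at most `M |b - y|` between
`y` and `b`. -/
theorem abs_taylor_le {g g' : ℝ → ℝ} {M : ℝ} (hg : ∀ x, HasDerivAt g (g' x) x)
    (hM : ∀ x y, |g' x - g' y| ≤ M * |x - y|) (y b : ℝ) :
    |g b - g y - g' y * (b - y)| ≤ M * |b - y| ^ 2 := by
  have hM0 : 0 ≤ M := by simpa using (abs_nonneg _).trans (hM 1 0)
  have key := Convex.norm_image_sub_le_of_norm_hasDerivWithin_le (f := fun t => g t - g' y * t)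
    (f' := fun t => g' t - g' y) (s := uIcc y b) (x := y) (y := b) (C := M * |b - y|)
    (fun t _ => ((hg t).sub (by simpa using (hasDerivAt_id t).const_mul (g' y))).hasDerivWithinAt)
    (fun t ht => (hM t y).trans
      (mul_le_mul_of_nonneg_left (abs_sub_left_of_mem_uIcc ht) hM0))
    (convex_uIcc y b) left_mem_uIcc right_mem_uIcc
  simp only [Real.norm_eq_abs] at key
  calc _ = |g b - g' y * b - (g y - g' y * y)| := by congr 1; ring
    _ ≤ M * |b - y| * |b - y| := key
    _ = _ := by ring

/-- The weights `1 - θ` and `θ` cancel the first-order Taylor terms at the two neighbouring nodes. A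
node missing from `S` is read as zero, at a cost of at most `δ`, and the weights sum to one. -/
theorem abs_sub_interpolation_le {g g' : ℝ → ℝ} {M δ h : ℝ} (hh : 0 < h)
    (hg : ∀ x, HasDerivAt g (g' x) x) (hM : ∀ x y, |g' x - g' y| ≤ M * |x - y|)
    (S : Finset ℤ) (hδ : 0 ≤ δ) (hS : ∀ j : ℤ, j ∉ S → |g (j * h)| ≤ δ) (y : ℝ) :
    |g y - (∑ j ∈ S, g (j * h) * tent h (y - j * h)) / h| ≤ M * h ^ 2 + δ := by
  have hM0 : 0 ≤ M := by simpa using (abs_nonneg _).trans (hM 1 0)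
  obtain ⟨n, θ, h0, h1, rfl⟩ := exists_grid_cell hh y
  rw [sum_mul_tent_grid hh S (fun j => g (j * h)) n h0 h1, mul_div_cancel_left₀ _ hh.ne']
  set y := h * ((n : ℝ) + θ) with hy
  have ea : (n : ℝ) * h - y = -(h * θ) := by rw [hy]; ring
  have eb : ((n + 1 : ℤ) : ℝ) * h - y = h * (1 - θ) := by rw [hy]; push_cast; ring
  have ta := abs_taylor_le hg hM y (n * h)
  have tb := abs_taylor_le hg hM y (((n + 1 : ℤ) : ℝ) * h)
  rw [ea, abs_neg, abs_of_nonneg (mul_nonneg hh.le h0)] at ta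
  rw [eb, abs_of_nonneg (mul_nonneg hh.le (by linarith))] at tb
  have ta' := ta.trans (mul_le_mul_of_nonneg_left
    (pow_le_pow_left₀ (mul_nonneg hh.le h0) (by nlinarith : h * θ ≤ h) 2) hM0)
  have tb' := tb.trans (mul_le_mul_of_nonneg_left
    (pow_le_pow_left₀ (mul_nonneg hh.le (by linarith)) (by nlinarith : h * (1 - θ) ≤ h) 2) hM0)
  have m1 : |g (n * h) - if n ∈ S then g (n * h) else 0| ≤ δ := by
    split_ifs with hn
    · simpa using hδ
    · simpa using hS n hn
  have m2 : |g ((n + 1 : ℤ) * h) - if n + 1 ∈ S then g ((n + 1 : ℤ) * h) else 0| ≤ δ := by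
    split_ifs with hn
    · simpa using hδ
    · simpa using hS (n + 1) hn
  set A := g (n * h)
  set B := g ((n + 1 : ℤ) * h)
  set A' := if n ∈ S then A else 0
  set B' := if n + 1 ∈ S then B else 0
  have e : g y - (A' * (1 - θ) + B' * θ)
      = -((1 - θ) * (A - g y - g' y * -(h * θ))) - θ * (B - g y - g' y * (h * (1 - θ)))
        + (1 - θ) * (A - A') + θ * (B - B') := by ring
  rw [e]
  rw [abs_le] at ta' tb' m1 m2 ⊢
  have hθ : 0 ≤ 1 - θ := by linarith
  constructor <;>
  nlinarith [mul_le_mul_of_nonneg_left ta'.1 hθ, mul_le_mul_of_nonneg_left ta'.2 hθ,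
    mul_le_mul_of_nonneg_left tb'.1 h0, mul_le_mul_of_nonneg_left tb'.2 h0,
    mul_le_mul_of_nonneg_left m1.1 hθ, mul_le_mul_of_nonneg_left m1.2 hθ,
    mul_le_mul_of_nonneg_left m2.1 h0, mul_le_mul_of_nonneg_left m2.2 h0]

theorem integral_tent {h : ℝ} (hh : 0 ≤ h) : ∫ z, tent h z = h ^ 2 := by
  have key := integral_mul_tent (g := fun t => t ^ 2 / 2) (g' := fun t => t) (g'' := fun _ => 1)
    (fun t => by simpa using ((hasDerivAt_pow 2 t).div_const 2)) (fun t => hasDerivAt_id t)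
    continuous_const hh 0
  simp only [one_mul, zero_sub, tent_neg] at key
  rw [key]
  ring

theorem integrable_mul_tent {a : ℝ → ℝ} (ha : Continuous a) (h : ℝ) :
    Integrable fun z => a z * tent h z :=
  (ha.mul (continuous_tent h)).integrable_of_hasCompactSupport (hasCompactSupport_tent h).mul_left

/-! ### Quadrature errors -/

theorem integrable_tent_sub {ν : Measure ℝ} [IsFiniteMeasure ν] {h : ℝ} (hh : 0 ≤ h) (x : ℝ) :
    Integrable (fun w => tent h (w - x)) ν :=
  integrable_of_continuous_of_bound ((continuous_tent h).comp (by fun_prop))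
    fun _ => abs_tent_le hh _

/-- The total variation of `μ` near `x`, weighted by a tent function. -/
def localVariation (μ : SignedMeasure ℝ) (h x : ℝ) : ℝ := ∫ w, tent h (w - x) ∂variationMeasure μ

/-- The factor `h` gained here keeps the accumulated cell errors of order `h²`, however many nodes
`S` has. -/
theorem sum_localVariation_le (μ : SignedMeasure ℝ) {h : ℝ} (hh : 0 < h) (S : Finset ℤ) (x : ℝ) :
    ∑ j ∈ S, localVariation μ h (x - j * h) ≤ h * (variationMeasure μ).real univ := by
  unfold localVariation
  rw [← integral_finsetSum _ fun j _ => integrable_tent_sub hh.le _]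
  calc _ ≤ ∫ _, h ∂variationMeasure μ := by
        refine integral_mono (integrable_finsetSum _ fun j _ => integrable_tent_sub hh.le _)
          (integrable_const h) fun w => ?_
        refine le_trans (le_of_eq (Finset.sum_congr rfl fun j _ => ?_))
          (sum_tent_grid_le hh S (x - w))
        rw [← tent_neg]
        congr 1
        ring
    _ = _ := by simp [mul_comm]

namespace KernelConditions

variable {α α' : ℝ → ℝ} {μ : SignedMeasure ℝ}

theorem abs_second_difference_le (hα : KernelConditions α α' μ) (x : ℝ) {z h : ℝ}
    (hz : |z| ≤ h) : |α' (x + z) - 2 * α' x + α' (x - z)| ≤ localVariation μ h x := by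
  have pos : ∀ {z : ℝ}, 0 ≤ z → z ≤ h →
      |α' (x + z) - 2 * α' x + α' (x - z)| ≤ localVariation μ h x := by
    intro z h0 h1
    rw [hα.second_difference_eq x h0]
    refine (abs_signedIntegral_le μ (integrable_tent_sub h0 x)).trans ?_
    refine integral_mono (integrable_tent_sub h0 x).abs (integrable_tent_sub (h0.trans h1) x)
      fun w => ?_
    dsimp only
    rw [abs_of_nonneg (tent_nonneg _ _)]
    exact tent_mono h1 _
  rcases le_total 0 z with h0 | h0
  · exact pos h0 ((le_abs_self z).trans hz)
  · have := pos (neg_nonneg.2 h0) ((neg_le_abs z).trans hz)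
    rwa [show α' (x + -z) - 2 * α' x + α' (x - -z) = α' (x + z) - 2 * α' x + α' (x - z) by
      rw [sub_neg_eq_add, ← sub_eq_add_neg]; ring] at this

/-- Since the tent is even with integral `h²`, averaging over `z` and `-z` turns the error into half
the integral of a second difference of `α'` against the tent. -/
theorem abs_cell_error_le (hα : KernelConditions α α' μ) (x : ℝ) {h : ℝ} (hh : 0 ≤ h) :
    |(∫ z, α' (x - z) * tent h z) - h ^ 2 * α' x| ≤ h ^ 2 / 2 * localVariation μ h x := by
  have c1 : Continuous fun z => α' (x - z) := hα.continuous_deriv.comp (by fun_prop)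
  have c2 : Continuous fun z => α' (x + z) := hα.continuous_deriv.comp (by fun_prop)
  have i1 := integrable_mul_tent c1 h
  have i2 := integrable_mul_tent c2 h
  have i3 := (integrable_mul_tent continuous_const h : Integrable fun z => α' x * tent h z)
  have e1 : ∫ z, α' (x + z) * tent h z = ∫ z, α' (x - z) * tent h z := by
    rw [← integral_neg_eq_self]
    simp only [tent_neg, ← sub_eq_add_neg]
  have e2 : ∫ z, α' x * tent h z = h ^ 2 * α' x := by
    rw [integral_const_mul, integral_tent hh, mul_comm]
  have e3 : (∫ z, α' (x - z) * tent h z) - h ^ 2 * α' x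
      = (∫ z, (α' (x + z) - 2 * α' x + α' (x - z)) * tent h z) / 2 := by
    have : ∫ z, (α' (x + z) - 2 * α' x + α' (x - z)) * tent h z
        = ∫ z, (α' (x + z) * tent h z - 2 * (α' x * tent h z)) + α' (x - z) * tent h z :=
      integral_congr_ae (Filter.Eventually.of_forall fun z => by ring)
    have i4 : Integrable fun z => α' (x + z) * tent h z - 2 * (α' x * tent h z) :=
      i2.sub (i3.const_mul 2)
    rw [this, integral_add i4 i1, integral_sub i2 (i3.const_mul 2),
      integral_const_mul, e1, e2]
    ring
  have e4 : ‖∫ z, (α' (x + z) - 2 * α' x + α' (x - z)) * tent h z‖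
      ≤ ∫ z, localVariation μ h x * tent h z := by
    refine norm_integral_le_of_norm_le (integrable_mul_tent continuous_const h)
      (Filter.Eventually.of_forall fun z => ?_)
    rw [Real.norm_eq_abs, abs_mul, abs_of_nonneg (tent_nonneg h z)]
    rcases le_total |z| h with hz | hz
    · exact mul_le_mul_of_nonneg_right (hα.abs_second_difference_le x hz) (tent_nonneg h z)
    · simp [tent_eq_zero hz]
  rw [integral_const_mul, integral_tent hh, Real.norm_eq_abs] at e4
  rw [e3, abs_div, abs_two]
  linarith

theorem integral_shift_tent (a : ℝ → ℝ) (x b h : ℝ) :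
    ∫ z, a (x - b - z) * tent h z = ∫ y, a (x - y) * tent h (y - b) := by
  rw [← integral_sub_right_eq_self (fun z => a (x - b - z) * tent h z) b]
  refine integral_congr_ae (Filter.Eventually.of_forall fun y => ?_)
  simp only [show x - b - (y - b) = x - y by ring]

theorem integrable_shift_tent {a : ℝ → ℝ} (ha : Integrable a) {h : ℝ} (hh : 0 ≤ h) (x b : ℝ) :
    Integrable fun y => a (x - y) * tent h (y - b) :=
  (ha.comp_sub_left x).mul_bdd (c := h)
    ((continuous_tent h).comp (by fun_prop)).aestronglyMeasurable
    (Filter.Eventually.of_forall fun _ => abs_tent_le hh _)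

/-- The discrete `ℓ¹` norm of the sampled kernel is bounded. -/
theorem sum_abs_kernel_le (hα : KernelConditions α α' μ) {h : ℝ} (hh : 0 < h) (S : Finset ℤ)
    (i : ℤ) :
    ∑ j ∈ S, |h * gridRestrict h α' (i - j)|
      ≤ (∫ y, |α' y|) + h ^ 2 / 2 * (variationMeasure μ).real univ := by
  -- The sample is compared with a tent average of `α'`; the extra factor `h` is cancelled after
  -- summation.
  have cell : ∀ j : ℤ, h * |h * gridRestrict h α' (i - j)|
      ≤ (∫ y, |α' (i * h - y)| * tent h (y - j * h))
        + h ^ 2 / 2 * localVariation μ h (i * h - j * h) := by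
    intro j
    have e : gridRestrict h α' (i - j) = α' (i * h - j * h) := by
      simp [gridRestrict, sub_mul]
    have h1 := hα.abs_cell_error_le (i * h - j * h) hh.le
    rw [e, ← abs_of_pos hh, ← abs_mul, abs_of_pos hh, ← mul_assoc, ← sq]
    have h2 : |∫ z, α' (i * h - j * h - z) * tent h z|
        ≤ ∫ y, |α' (i * h - y)| * tent h (y - j * h) := by
      rw [integral_shift_tent]
      refine abs_integral_le_integral_abs.trans (le_of_eq ?_)
      refine integral_congr_ae (Filter.Eventually.of_forall fun y => ?_)
      simp only [abs_mul, abs_of_nonneg (tent_nonneg _ _)]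
    rw [abs_le] at h1 h2 ⊢
    constructor <;> linarith [h1.1, h1.2, h2.1, h2.2]
  have hint : ∀ j : ℤ, Integrable fun y => |α' (i * h - y)| * tent h (y - j * h) := fun j =>
    integrable_shift_tent hα.integrable_deriv.abs hh.le _ _
  have total : ∑ j ∈ S, ∫ y, |α' (i * h - y)| * tent h (y - j * h) ≤ h * ∫ y, |α' y| := by
    rw [← integral_finsetSum _ fun j _ => hint j,
      ← integral_sub_left_eq_self (fun y => |α' y|) _ ((i : ℝ) * h), ← integral_const_mul]
    refine integral_mono (integrable_finsetSum _ fun j _ => hint j)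
      ((hα.integrable_deriv.abs.comp_sub_left _).const_mul h) fun y => ?_
    dsimp only
    rw [← Finset.mul_sum, mul_comm h]
    exact mul_le_mul_of_nonneg_left (sum_tent_grid_le hh S y) (abs_nonneg _)
  have := Finset.sum_le_sum fun j (_ : j ∈ S) => cell j
  rw [← Finset.mul_sum, Finset.sum_add_distrib, ← Finset.mul_sum] at this
  have hv := mul_le_mul_of_nonneg_left (sum_localVariation_le μ hh S (i * h))
    (by positivity : 0 ≤ h ^ 2 / 2)
  refine le_of_mul_le_mul_left ?_ hh
  linarith

theorem mul_secondDiff_eq (hα : KernelConditions α α' μ) {h : ℝ} (hh : 0 < h) (i j : ℤ) :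
    h * secondDiff h (gridRestrict h α') (i - j)
      = signedIntegral μ (fun w => tent h (w - (i * h - j * h))) / h := by
  rw [← hα.second_difference_eq _ hh.le]
  simp only [secondDiff, gridRestrict]
  push_cast
  rw [show ((i : ℝ) - j + 1) * h = i * h - j * h + h by ring,
    show ((i : ℝ) - j - 1) * h = i * h - j * h - h by ring,
    show ((i : ℝ) - j) * h = i * h - j * h by ring]
  field_simp

/-- The discrete `ℓ¹` norm of the second differences of the sampled kernel is bounded. -/
theorem sum_abs_secondDiff_le (hα : KernelConditions α α' μ) {h : ℝ} (hh : 0 < h) (S : Finset ℤ)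
    (i : ℤ) :
    ∑ j ∈ S, |h * secondDiff h (gridRestrict h α') (i - j)| ≤ (variationMeasure μ).real univ := by
  have cell : ∀ j : ℤ, |h * secondDiff h (gridRestrict h α') (i - j)|
      ≤ localVariation μ h (i * h - j * h) / h := by
    intro j
    rw [hα.mul_secondDiff_eq hh, ← hα.second_difference_eq _ hh.le, abs_div, abs_of_pos hh]
    exact div_le_div_of_nonneg_right
      (hα.abs_second_difference_le _ (abs_of_pos hh).le) hh.le
  refine (Finset.sum_le_sum fun j _ => cell j).trans ?_
  rw [← Finset.sum_div, div_le_iff₀ hh, mul_comm ((variationMeasure μ).real univ)]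
  exact sum_localVariation_le μ hh S _

/-- No quadrature error arises beyond interpolation: by the tent identity the sum is the
`μ`-integral of the interpolant of `g`, with nodes in `S`, evaluated at `ih - w`. -/
theorem abs_signedIntegral_sub_sum_le (hα : KernelConditions α α' μ) {g g' : ℝ → ℝ}
    {M B δ h : ℝ} (hh : 0 < h) (hg : ∀ x, HasDerivAt g (g' x) x)
    (hM : ∀ x y, |g' x - g' y| ≤ M * |x - y|) (hB : ∀ x, |g x| ≤ B)
    (S : Finset ℤ) (hδ : 0 ≤ δ) (hS : ∀ j : ℤ, j ∉ S → |g (j * h)| ≤ δ) (i : ℤ) :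
    |signedIntegral μ (fun y => g (i * h - y))
        - ∑ j ∈ S, h * secondDiff h (gridRestrict h α') (i - j) * g (j * h)|
      ≤ (M * h ^ 2 + δ) * (variationMeasure μ).real univ := by
  have hgc : Continuous g := continuous_iff_continuousAt.2 fun x => (hg x).continuousAt
  have ig : Integrable (fun y => g (i * h - y)) (variationMeasure μ) :=
    integrable_of_continuous_of_bound (hgc.comp (by fun_prop)) fun _ => hB _
  have it : ∀ j : ℤ, Integrable (fun w => g (j * h) / h * tent h (w - (i * h - j * h)))
      (variationMeasure μ) := fun j => (integrable_tent_sub hh.le _).const_mul _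
  have e : ∑ j ∈ S, h * secondDiff h (gridRestrict h α') (i - j) * g (j * h)
      = signedIntegral μ (fun w => ∑ j ∈ S, g (j * h) / h * tent h (w - (i * h - j * h))) := by
    rw [signedIntegral_sum μ S fun j _ => it j]
    refine Finset.sum_congr rfl fun j _ => ?_
    rw [hα.mul_secondDiff_eq hh, signedIntegral_const_mul]
    ring
  have is := integrable_finsetSum S fun j _ => it j
  rw [e, ← signedIntegral_sub μ ig is]
  refine abs_signedIntegral_le_of_le μ (ig.sub is) fun y => ?_
  refine le_trans (le_of_eq ?_) (abs_sub_interpolation_le hh hg hM S hδ hS (i * h - y))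
  congr 2
  rw [Finset.sum_div]
  refine Finset.sum_congr rfl fun j _ => ?_
  rw [← tent_neg, show -(y - (i * h - j * h)) = i * h - y - j * h by ring]
  ring

/-- Pass through the interpolant `I` of `g`: `g - I` is small uniformly and is integrated against
`|α'|`, while `α' * I` differs from the sum by cell errors weighted by at most `B / h`. -/
theorem abs_convolution_sub_sum_le (hα : KernelConditions α α' μ) {g g' : ℝ → ℝ}
    {M B δ h : ℝ} (hh : 0 < h) (hg : ∀ x, HasDerivAt g (g' x) x)
    (hM : ∀ x y, |g' x - g' y| ≤ M * |x - y|) (hB : ∀ x, |g x| ≤ B)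
    (S : Finset ℤ) (hδ : 0 ≤ δ) (hS : ∀ j : ℤ, j ∉ S → |g (j * h)| ≤ δ) (i : ℤ) :
    |(∫ y, α' (i * h - y) * g y) - ∑ j ∈ S, h * gridRestrict h α' (i - j) * g (j * h)|
      ≤ (M * h ^ 2 + δ) * (∫ y, |α' y|) + B * (h ^ 2 / 2) * (variationMeasure μ).real univ := by
  have hB0 : 0 ≤ B := (abs_nonneg _).trans (hB 0)
  have hgc : Continuous g := continuous_iff_continuousAt.2 fun x => (hg x).continuousAt
  set I : ℝ → ℝ := fun y => (∑ j ∈ S, g (j * h) * tent h (y - j * h)) / h with hI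
  have ia : Integrable fun y => α' (i * h - y) := hα.integrable_deriv.comp_sub_left _
  have ig : Integrable fun y => α' (i * h - y) * g y :=
    ia.mul_bdd (c := B) hgc.aestronglyMeasurable (Filter.Eventually.of_forall hB)
  have it : ∀ j : ℤ, Integrable fun y => g (j * h) / h * (α' (i * h - y) * tent h (y - j * h)) :=
    fun j => (integrable_shift_tent hα.integrable_deriv hh.le _ _).const_mul _
  have eI : ∀ y, α' (i * h - y) * I y
      = ∑ j ∈ S, g (j * h) / h * (α' (i * h - y) * tent h (y - j * h)) := by
    intro y
    simp only [hI]
    rw [Finset.sum_div, Finset.mul_sum]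
    exact Finset.sum_congr rfl fun j _ => by ring
  have iI : Integrable fun y => α' (i * h - y) * I y := by
    simp only [eI]
    exact integrable_finsetSum S fun j _ => it j
  have p1 : |(∫ y, α' (i * h - y) * g y) - ∫ y, α' (i * h - y) * I y|
      ≤ (M * h ^ 2 + δ) * ∫ y, |α' y| := by
    rw [← integral_sub ig iI, ← integral_sub_left_eq_self (fun y => |α' y|) _ ((i : ℝ) * h),
      ← integral_const_mul, ← Real.norm_eq_abs]
    refine norm_integral_le_of_norm_le (ia.abs.const_mul _) (Filter.Eventually.of_forall fun y => ?_)
    rw [← mul_sub, Real.norm_eq_abs, abs_mul, mul_comm]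
    exact mul_le_mul_of_nonneg_right (abs_sub_interpolation_le hh hg hM S hδ hS y) (abs_nonneg _)
  have cell : ∀ j : ℤ, |(∫ y, g (j * h) / h * (α' (i * h - y) * tent h (y - j * h)))
      - h * gridRestrict h α' (i - j) * g (j * h)|
      ≤ B / h * (h ^ 2 / 2 * localVariation μ h (i * h - j * h)) := by
    intro j
    have e : gridRestrict h α' (i - j) = α' (i * h - j * h) := by
      simp [gridRestrict, sub_mul]
    rw [integral_const_mul, ← integral_shift_tent, e,
      show g (j * h) / h * (∫ z, α' (i * h - j * h - z) * tent h z)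
          - h * α' (i * h - j * h) * g (j * h)
        = g (j * h) / h * ((∫ z, α' (i * h - j * h - z) * tent h z)
          - h ^ 2 * α' (i * h - j * h)) by field_simp, abs_mul, abs_div, abs_of_pos hh]
    exact mul_le_mul (div_le_div_of_nonneg_right (hB _) hh.le) (hα.abs_cell_error_le _ hh.le)
      (abs_nonneg _) (by positivity)
  have p2 : |(∫ y, α' (i * h - y) * I y)
      - ∑ j ∈ S, h * gridRestrict h α' (i - j) * g (j * h)|
      ≤ B * (h ^ 2 / 2) * (variationMeasure μ).real univ := by
    simp only [eI]
    rw [integral_finsetSum S fun j _ => it j, ← Finset.sum_sub_distrib]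
    refine (Finset.abs_sum_le_sum_abs _ _).trans ((Finset.sum_le_sum fun j _ => cell j).trans ?_)
    rw [← Finset.mul_sum, ← Finset.mul_sum]
    calc _ ≤ B / h * (h ^ 2 / 2 * (h * (variationMeasure μ).real univ)) := by
          gcongr
          exact sum_localVariation_le μ hh S _
      _ = _ := by field_simp
  exact (abs_sub_le _ _ _).trans (add_le_add p1 p2)

end KernelConditions

/-! ### Ordinary differential equations -/

/-- With speed at most `B` a trajectory stays in the ball of radius `B * T`, so one application of
Picard–Lindelöf covers all of `[0,T]`. -/
theorem exists_solution_of_lipschitz_of_bounded {E : Type*} [NormedAddCommGroup E]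
    [NormedSpace ℝ E] [CompleteSpace E] {G : E → E} {K : NNReal} {B T : ℝ} (hG : LipschitzWith K G)
    (hB : ∀ x, ‖G x‖ ≤ B) (hT : 0 ≤ T) (x₀ : E) :
    ∃ v : ℝ → E, v 0 = x₀ ∧ ∀ t ∈ Icc 0 T, HasDerivWithinAt v (G (v t)) (Icc 0 T) t := by
  have hB0 : 0 ≤ B := (norm_nonneg _).trans (hB 0)
  have hPL : IsPicardLindelof (fun _ => G) (tmin := 0) (tmax := T) ⟨0, left_mem_Icc.2 hT⟩ x₀
      (B * T).toNNReal 0 B.toNNReal K :=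
    { lipschitzOnWith := fun _ _ => hG.lipschitzOnWith
      continuousOn := fun _ _ => continuousOn_const
      norm_le := fun _ _ x _ => by rw [Real.coe_toNNReal _ hB0]; exact hB x
      mul_max_le := by
        rw [Real.coe_toNNReal _ hB0, Real.coe_toNNReal _ (mul_nonneg hB0 hT)]
        simp [hT] }
  exact hPL.exists_eq_forall_mem_Icc_hasDerivWithinAt₀

theorem HasDerivWithinAt.Ici_of_Icc {E : Type*} [NormedAddCommGroup E] [NormedSpace ℝ E]
    {v : ℝ → E} {v' : E} {a b t : ℝ} (h : HasDerivWithinAt v v' (Icc a b) t) (ht : t ∈ Ico a b) :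
    HasDerivWithinAt v v' (Ici t) t :=
  h.mono_of_mem_nhdsWithin (Icc_mem_nhdsGE_of_mem ht)

theorem gronwallBound_zero_eq_mul (K ε x : ℝ) :
    gronwallBound 0 K ε x = ε * gronwallBound 0 K 1 x := by
  by_cases hK : K = 0
  · simp [hK, gronwallBound_K0]
  · simp only [gronwallBound_of_K_ne_0 hK]
    ring

/-! ### Truncation of the values -/

/-- Truncation of a real number to `[-R, R]`. -/
def clamp (R x : ℝ) : ℝ := max (-R) (min R x)

theorem abs_clamp_le {R : ℝ} (hR : 0 ≤ R) (x : ℝ) : |clamp R x| ≤ R :=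
  abs_le.2 ⟨le_max_left _ _, max_le (by linarith) (min_le_left _ _)⟩

theorem clamp_of_abs_le {R x : ℝ} (hx : |x| ≤ R) : clamp R x = x := by
  rw [abs_le] at hx
  rw [clamp, min_eq_right hx.2, max_eq_right hx.1]

theorem abs_clamp_sub_le (R x y : ℝ) : |clamp R x - clamp R y| ≤ |x - y| := by
  refine (abs_max_sub_max_le_max _ _ _ _).trans (max_le (by simp) ?_)
  exact (abs_min_sub_min_le_max _ _ _ _).trans (by simp)

theorem exists_lipschitz_of_contDiff {g : ℝ → ℝ} (hg : ContDiff ℝ 1 g) (R : ℝ) :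
    ∃ L : ℝ, 0 ≤ L ∧ (∀ x, |x| ≤ R → |deriv g x| ≤ L) ∧
      ∀ x y, |x| ≤ R → |y| ≤ R → |g x - g y| ≤ L * |x - y| := by
  obtain ⟨L, hL⟩ := (isCompact_Icc (a := -R) (b := R)).exists_bound_of_continuousOn
    (hg.continuous_deriv le_rfl).continuousOn
  refine ⟨max L 0, le_max_right _ _, fun x hx => (hL x (abs_le.1 hx)).trans (le_max_left _ _),
    fun x y hx hy => ?_⟩
  exact Convex.norm_image_sub_le_of_norm_deriv_le (s := Icc (-R) R)
    (fun x _ => hg.differentiable one_ne_zero x)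
    (fun x hx => (hL x hx).trans (le_max_left _ _)) (convex_Icc _ _) (abs_le.1 hy) (abs_le.1 hx)

/-! ### The vector field of the truncated system -/

namespace KernelConditions

variable {α α' : ℝ → ℝ} {μ : SignedMeasure ℝ} {f : ℝ → ℝ} {κ h : ℝ}

/-- A Lipschitz constant, uniform in the mesh size `h ≤ 1` and in the truncation index, of the
vector field of the truncated system, if `f` has Lipschitz constant `L`. -/
def lipConst (α' : ℝ → ℝ) (μ : SignedMeasure ℝ) (κ L : ℝ) : ℝ :=
  ((∫ y, |α' y|) + (variationMeasure μ).real univ) * L + κ * (variationMeasure μ).real univ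

theorem lipConst_nonneg (α' : ℝ → ℝ) (μ : SignedMeasure ℝ) {κ L : ℝ} (hκ : 0 ≤ κ) (hL : 0 ≤ L) :
    0 ≤ lipConst α' μ κ L := by
  have : 0 ≤ ∫ y, |α' y| := integral_nonneg fun _ => abs_nonneg _
  unfold lipConst
  positivity

/-- Row-sum estimate in the sup norm. Assuming the increment bound on `f` only along `v` and `w`
allows clamped arguments, and `w = 0` yields a size bound. -/
theorem dist_truncRHS_le (hα : KernelConditions α α' μ) (hκ : 0 ≤ κ) (hh : 0 < h) (h1 : h ≤ 1)
    {N : ℕ} {L d : ℝ} (hL : 0 ≤ L) (hd : 0 ≤ d) {v w : TruncIdx N → ℝ}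
    (hvw : ∀ j, |v j - w j| ≤ d) (hf : ∀ j, |f (v j) - f (w j)| ≤ L * d) :
    dist (truncRHS α' f κ h N v) (truncRHS α' f κ h N w) ≤ lipConst α' μ κ L * d := by
  have hV : 0 ≤ (variationMeasure μ).real univ := measureReal_nonneg
  rw [dist_pi_le_iff (mul_nonneg (lipConst_nonneg α' μ hκ hL) hd)]
  intro i
  have bound : ∀ (a : ℤ → ℝ) (x y : TruncIdx N → ℝ) (A c : ℝ), 0 ≤ c →
      (∑ j ∈ Finset.Icc (-(N : ℤ)) N, |a j| ≤ A) → (∀ j, |x j - y j| ≤ c) →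
      |(∑ j : TruncIdx N, a j * x j) - ∑ j : TruncIdx N, a j * y j| ≤ A * c := by
    intro a x y A c hc hA hxy
    rw [← Finset.sum_sub_distrib]
    calc _ ≤ ∑ j : TruncIdx N, |a j| * c := by
          refine (Finset.abs_sum_le_sum_abs _ _).trans (Finset.sum_le_sum fun j _ => ?_)
          rw [← mul_sub, abs_mul]
          exact mul_le_mul_of_nonneg_left (hxy j) (abs_nonneg _)
      _ = (∑ j ∈ Finset.Icc (-(N : ℤ)) N, |a j|) * c := by
          rw [← Finset.sum_mul, Finset.sum_coe_sort (Finset.Icc (-(N : ℤ)) N) fun j => |a j|]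
      _ ≤ A * c := mul_le_mul_of_nonneg_right hA hc
  have hA : ∑ j ∈ Finset.Icc (-(N : ℤ)) N, |h * gridRestrict h α' ((i : ℤ) - j)|
      ≤ (∫ y, |α' y|) + (variationMeasure μ).real univ := by
    refine (hα.sum_abs_kernel_le hh _ i).trans ?_
    have : h ^ 2 / 2 ≤ 1 := by nlinarith
    nlinarith
  have b1 := bound (fun j => h * gridRestrict h α' ((i : ℤ) - j)) (fun j => f (v j))
    (fun j => f (w j)) _ (L * d) (by positivity) hA hf
  have b2 := bound (fun j => h * secondDiff h (gridRestrict h α') ((i : ℤ) - j)) v w _ d hd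
    (hα.sum_abs_secondDiff_le hh _ i) hvw
  have b3 := mul_le_mul_of_nonneg_left b2 hκ
  rw [← abs_of_nonneg hκ, ← abs_mul, abs_of_nonneg hκ, mul_sub] at b3
  rw [Real.dist_eq, lipConst]
  unfold truncRHS
  rw [abs_le] at b1 b3 ⊢
  constructor <;> linarith [b1.1, b1.2, b3.1, b3.2]

/-- The vector field of the truncated system with all values truncated to `[-R, R]`. -/
def clampedRHS (α' f : ℝ → ℝ) (κ h : ℝ) (N : ℕ) (R : ℝ) (v : TruncIdx N → ℝ) : TruncIdx N → ℝ :=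
  truncRHS α' f κ h N fun j => clamp R (v j)

theorem clampedRHS_eq {N : ℕ} {R : ℝ} {v : TruncIdx N → ℝ} (hv : ∀ j, |v j| ≤ R) :
    clampedRHS α' f κ h N R v = truncRHS α' f κ h N v := by
  unfold clampedRHS
  congr 1
  exact funext fun j => clamp_of_abs_le (hv j)

theorem lipschitzWith_clampedRHS (hα : KernelConditions α α' μ) (hκ : 0 ≤ κ) (hh : 0 < h)
    (h1 : h ≤ 1) {N : ℕ} {L R : ℝ} (hL : 0 ≤ L) (hR : 0 ≤ R)
    (hf : ∀ x y, |x| ≤ R → |y| ≤ R → |f x - f y| ≤ L * |x - y|) :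
    LipschitzWith (lipConst α' μ κ L).toNNReal (clampedRHS α' f κ h N R) := by
  refine LipschitzWith.of_dist_le_mul fun v w => ?_
  rw [Real.coe_toNNReal _ (lipConst_nonneg α' μ hκ hL)]
  have hvw : ∀ j, |clamp R (v j) - clamp R (w j)| ≤ dist v w := fun j =>
    (abs_clamp_sub_le _ _ _).trans (dist_le_pi_dist v w j)
  exact hα.dist_truncRHS_le hκ hh h1 hL dist_nonneg hvw fun j =>
    (hf _ _ (abs_clamp_le hR _) (abs_clamp_le hR _)).trans (mul_le_mul_of_nonneg_left (hvw j) hL)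

theorem norm_clampedRHS_le (hα : KernelConditions α α' μ) (hκ : 0 ≤ κ) (hh : 0 < h)
    (h1 : h ≤ 1) {N : ℕ} {L R : ℝ} (hL : 0 ≤ L) (hR : 0 ≤ R) (hf0 : f 0 = 0)
    (hf : ∀ x y, |x| ≤ R → |y| ≤ R → |f x - f y| ≤ L * |x - y|) (v : TruncIdx N → ℝ) :
    ‖clampedRHS α' f κ h N R v‖ ≤ lipConst α' μ κ L * R := by
  have h0 : truncRHS α' f κ h N 0 = 0 := by
    funext i
    simp [truncRHS, hf0]
  have hv : ∀ j, |clamp R (v j) - (0 : TruncIdx N → ℝ) j| ≤ R := fun j => by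
    simpa using abs_clamp_le hR (v j)
  rw [← dist_zero_right, ← h0]
  exact hα.dist_truncRHS_le hκ hh h1 hL hR hv fun j =>
    (hf _ _ (abs_clamp_le hR _) (by simpa using hR)).trans (mul_le_mul_of_nonneg_left (hv j) hL)

/-- Two solutions of the truncated system with the same initial value agree. -/
theorem truncSolution_unique (hα : KernelConditions α α' μ) (hκ : 0 ≤ κ) (hh : 0 < h)
    (h1 : h ≤ 1) (hf : ContDiff ℝ 1 f) {T : ℝ} {N : ℕ} {v₀ : TruncIdx N → ℝ}
    {v w : ℝ → TruncIdx N → ℝ} (hv : IsTruncSolution α' f κ h T N v₀ v)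
    (hw : IsTruncSolution α' f κ h T N v₀ w) : EqOn v w (Icc 0 T) := by
  have cv : ContinuousOn v (Icc 0 T) := fun t ht => (hv.equation t ht).continuousWithinAt
  have cw : ContinuousOn w (Icc 0 T) := fun t ht => (hw.equation t ht).continuousWithinAt
  obtain ⟨B₁, hB₁⟩ := isCompact_Icc.exists_bound_of_continuousOn cv
  obtain ⟨B₂, hB₂⟩ := isCompact_Icc.exists_bound_of_continuousOn cw
  -- Both solutions stay in `[-R, R]` on the compact interval, hence solve the same clamped,
  -- globally Lipschitz system.
  set R := max (max B₁ B₂) 0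
  have hR : 0 ≤ R := le_max_right _ _
  obtain ⟨L, hL, -, hfL⟩ := exists_lipschitz_of_contDiff hf R
  have bv : ∀ t ∈ Icc 0 T, ∀ j, |v t j| ≤ R := fun t ht j => (norm_le_pi_norm (v t) j).trans
    ((hB₁ t ht).trans ((le_max_left _ _).trans (le_max_left _ _)))
  have bw : ∀ t ∈ Icc 0 T, ∀ j, |w t j| ≤ R := fun t ht j => (norm_le_pi_norm (w t) j).trans
    ((hB₂ t ht).trans ((le_max_right _ _).trans (le_max_left _ _)))
  refine ODE_solution_unique_of_mem_Icc_right (v := fun _ => clampedRHS α' f κ h N R)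
    (s := fun _ => univ)
    (fun t _ => (hα.lipschitzWith_clampedRHS hκ hh h1 hL hR hfL).lipschitzOnWith)
    cv (fun t ht => ?_) (fun _ _ => mem_univ _) cw (fun t ht => ?_) (fun _ _ => mem_univ _)
    (hv.initial.trans hw.initial.symm)
  · rw [clampedRHS_eq (bv t (Ico_subset_Icc_self ht))]
    exact (hv.equation t (Ico_subset_Icc_self ht)).Ici_of_Icc ht
  · rw [clampedRHS_eq (bw t (Ico_subset_Icc_self ht))]
    exact (hw.equation t (Ico_subset_Icc_self ht)).Ici_of_Icc ht

end KernelConditions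

/-! ### The exact solution on the grid -/

/-- A continuous curve in `H^s(ℝ)` vanishes at infinity uniformly on a compact time interval. -/
theorem SobolevH.exists_uniform_decay {s : ℝ} (hs : 5 / 2 < s) {u : ℝ → SobolevH s} {T : ℝ}
    (hu : ContinuousOn u (Icc 0 T)) {δ : ℝ} (hδ : 0 < δ) :
    ∃ r : ℝ, ∀ x, r < |x| → ∀ t ∈ Icc 0 T, |(u t).rep x| ≤ δ := by
  obtain ⟨C, hC, hemb⟩ := exists_embedding_const hs
  have key : ∀ᶠ x in Filter.cocompact ℝ, ∀ t ∈ Icc 0 T, |(u t).rep x| ≤ δ := by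
    refine isCompact_Icc.induction_on (p := fun S : Set ℝ =>
      ∀ᶠ x in Filter.cocompact ℝ, ∀ t ∈ S, |(u t).rep x| ≤ δ) ?_ ?_ ?_ ?_
    · simp
    · exact fun S S' hSS h => h.mono fun x hx t ht => hx t (hSS ht)
    · exact fun S S' h h' => (h.and h').mono fun x hx t ht => ht.elim (hx.1 t) (hx.2 t)
    · intro t₀ ht₀
      -- Half of `δ` is for the decay of `u t₀`, half for the `H^s` distance from it; `C + 1` avoids
      -- division by zero.
      have hη : 0 < δ / 2 / (C + 1) := by positivity
      refine ⟨_, (hu t₀ ht₀) (Metric.ball_mem_nhds (u t₀) hη), ?_⟩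
      filter_upwards [(hemb (u t₀)).2.1 (Metric.ball_mem_nhds 0 (half_pos hδ))] with x hx t ht
      have h1 : |(u t₀).rep x| < δ / 2 := by simpa using hx
      have h2 : ‖u t - u t₀‖ < δ / 2 / (C + 1) := by simpa [dist_eq_norm] using ht
      obtain ⟨L, hL⟩ := exists_eval hs x
      have h3 := (hemb (u t - u t₀)).2.2.1 x
      rw [← hL, map_sub, hL, hL] at h3
      have h4 : C * ‖u t - u t₀‖ ≤ δ / 2 := by
        rw [lt_div_iff₀ (by positivity)] at h2
        nlinarith [norm_nonneg (u t - u t₀)]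
      rw [abs_le] at h3 ⊢
      rw [abs_lt] at h1
      constructor <;> linarith [h1.1, h1.2, h3.1, h3.2]
  obtain ⟨r, hr⟩ := (Metric.mem_cocompact_iff_closedBall_compl_subset (0 : ℝ)).1 key
  exact ⟨r, fun x hx => hr (by simpa using hx)⟩

/-- The values of the exact solution at the grid points. -/
def gridValues {s : ℝ} (u : ℝ → SobolevH s) (h : ℝ) (N : ℕ) (t : ℝ) : TruncIdx N → ℝ :=
  truncate N (gridRestrict h (u t).rep)

theorem ContDiffOn.hasDerivWithinAt_gridValues {s : ℝ} (hs : 5 / 2 < s) {u : ℝ → SobolevH s} {T : ℝ}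
    (hu : ContDiffOn ℝ 1 u (Icc 0 T)) (h : ℝ) (N : ℕ) {t : ℝ} (ht : t ∈ Icc 0 T) :
    HasDerivWithinAt (gridValues u h N) (gridValues (derivWithin u (Icc 0 T)) h N t) (Icc 0 T) t := by
  rw [hasDerivWithinAt_pi]
  intro i
  obtain ⟨L, hL⟩ := SobolevH.exists_eval hs (((i : ℤ) : ℝ) * h)
  have hd := (hu.differentiableOn one_ne_zero t ht).hasDerivWithinAt
  have := L.hasFDerivAt.comp_hasDerivWithinAt t hd
  simp only [hL] at this
  refine this.congr_of_mem (fun y _ => ?_) ht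
  simp [gridValues, truncate, gridRestrict, hL]

theorem ContinuousOn.gridValues {s : ℝ} (hs : 5 / 2 < s) {u : ℝ → SobolevH s} {S : Set ℝ}
    (hu : ContinuousOn u S) (h : ℝ) (N : ℕ) : ContinuousOn (gridValues u h N) S := by
  rw [continuousOn_pi]
  intro i
  obtain ⟨L, hL⟩ := SobolevH.exists_eval hs (((i : ℤ) : ℝ) * h)
  refine (L.continuous.comp_continuousOn hu).congr fun t _ => ?_
  simp [_root_.gridValues, truncate, gridRestrict, hL]

namespace KernelConditions

variable {α α' : ℝ → ℝ} {μ : SignedMeasure ℝ} {f : ℝ → ℝ} {κ h : ℝ}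

/-- The exact spatial operator and its truncated discretization differ by `O(h² + δ)` at the grid
points, where `δ` bounds the values outside the truncated grid. -/
theorem exists_consistency_const (hα : KernelConditions α α' μ) (hκ : 0 ≤ κ)
    (hf : ContDiff ℝ 2 f) (hf0 : f 0 = 0) {M : ℝ} (hM : 0 ≤ M) :
    ∃ C : ℝ, 0 ≤ C ∧ ∀ g g' : ℝ → ℝ, (∀ x, HasDerivAt g (g' x) x) → (∀ x, |g x| ≤ M) →
      (∀ x, |g' x| ≤ M) → (∀ x y, |g' x - g' y| ≤ M * |x - y|) →
      ∀ (h δ : ℝ) (N : ℕ), 0 < h → 0 ≤ δ →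
        (∀ j : ℤ, j ∉ Finset.Icc (-(N : ℤ)) N → |g (j * h)| ≤ δ) → ∀ i : TruncIdx N,
        |-(∫ y, α' ((i : ℤ) * h - y) * f (g y))
            - κ * signedIntegral μ (fun y => g ((i : ℤ) * h - y))
            - truncRHS α' f κ h N (truncate N (gridRestrict h g)) i| ≤ C * (h ^ 2 + δ) := by
  have hf1 : ContDiff ℝ 1 f := hf.of_le (by norm_num)
  have hf' : ContDiff ℝ 1 (deriv f) := (contDiff_succ_iff_deriv (n := 1)).1 hf |>.2.2
  obtain ⟨L₁, hL₁, hd₁, hl₁⟩ := exists_lipschitz_of_contDiff hf1 M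
  obtain ⟨L₂, hL₂, -, hl₂⟩ := exists_lipschitz_of_contDiff hf' M
  set A := ∫ y, |α' y| with hA
  have hA0 : 0 ≤ A := integral_nonneg fun _ => abs_nonneg _
  set V := (variationMeasure μ).real univ with hV
  have hV0 : 0 ≤ V := measureReal_nonneg
  -- Lipschitz constant of the derivative of `f ∘ g`, from the product rule.
  set MF := L₂ * M * M + L₁ * M with hMF
  -- The first two terms come from the convolution with `α'`, the last from the integral against
  -- `μ`.
  refine ⟨(MF + L₁) * A + L₁ * M * V + κ * ((M + 1) * V), by positivity, ?_⟩
  intro g g' hg hgM hg'M hlip h δ N hh hδ hS i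
  have gl : ∀ x y, |g x - g y| ≤ M * |x - y| := fun x y =>
    Convex.norm_image_sub_le_of_norm_hasDerivWithin_le (s := univ)
      (fun t _ => (hg t).hasDerivWithinAt) (fun t _ => hg'M t) convex_univ (mem_univ y) (mem_univ x)
  have Fd : ∀ x, HasDerivAt (fun y => f (g y)) (deriv f (g x) * g' x) x := fun x =>
    ((hf1.differentiable one_ne_zero (g x)).hasDerivAt).comp x (hg x)
  have Fl : ∀ x y, |deriv f (g x) * g' x - deriv f (g y) * g' y| ≤ MF * |x - y| := by
    intro x y
    have e : deriv f (g x) * g' x - deriv f (g y) * g' y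
        = (deriv f (g x) - deriv f (g y)) * g' x + deriv f (g y) * (g' x - g' y) := by ring
    rw [e]
    refine (abs_add_le _ _).trans ?_
    rw [abs_mul, abs_mul]
    have p1 : |deriv f (g x) - deriv f (g y)| ≤ L₂ * (M * |x - y|) :=
      (hl₂ _ _ (hgM x) (hgM y)).trans (mul_le_mul_of_nonneg_left (gl x y) hL₂)
    calc _ ≤ L₂ * (M * |x - y|) * M + L₁ * (M * |x - y|) :=
          add_le_add (mul_le_mul p1 (hg'M x) (abs_nonneg _) (by positivity))
            (mul_le_mul (hd₁ _ (hgM y)) (hlip x y) (abs_nonneg _) hL₁)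
      _ = _ := by rw [hMF]; ring
  have F0 : ∀ x, |f (g x)| ≤ L₁ * |g x| := fun x => by
    simpa [hf0] using hl₁ (g x) 0 (hgM x) (by simpa using hM)
  have FB : ∀ x, |f (g x)| ≤ L₁ * M := fun x =>
    (F0 x).trans (mul_le_mul_of_nonneg_left (hgM x) hL₁)
  have e1 := hα.abs_convolution_sub_sum_le hh Fd Fl FB (Finset.Icc (-(N : ℤ)) N)
    (δ := L₁ * δ) (by positivity)
    (fun j hj => (F0 _).trans (mul_le_mul_of_nonneg_left (hS j hj) hL₁)) i
  have e2 := mul_le_mul_of_nonneg_left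
    (hα.abs_signedIntegral_sub_sum_le hh hg hlip hgM (Finset.Icc (-(N : ℤ)) N) hδ hS i) hκ
  rw [← abs_of_nonneg hκ, ← abs_mul, abs_of_nonneg hκ] at e2
  have s1 : ∑ j : TruncIdx N, h * gridRestrict h α' ((i : ℤ) - (j : ℤ)) *
      f (truncate N (gridRestrict h g) j)
      = ∑ j ∈ Finset.Icc (-(N : ℤ)) N, h * gridRestrict h α' ((i : ℤ) - j) * f (g (j * h)) :=
    Finset.sum_coe_sort (Finset.Icc (-(N : ℤ)) N)
      fun j => h * gridRestrict h α' ((i : ℤ) - j) * f (g (j * h))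
  have s2 : ∑ j : TruncIdx N, h * secondDiff h (gridRestrict h α') ((i : ℤ) - (j : ℤ)) *
      truncate N (gridRestrict h g) j
      = ∑ j ∈ Finset.Icc (-(N : ℤ)) N, h * secondDiff h (gridRestrict h α') ((i : ℤ) - j)
          * g (j * h) :=
    Finset.sum_coe_sort (Finset.Icc (-(N : ℤ)) N)
      fun j => h * secondDiff h (gridRestrict h α') ((i : ℤ) - j) * g (j * h)
  unfold truncRHS
  rw [s1, s2]
  set a := ∫ y, α' ((i : ℤ) * h - y) * f (g y)
  set b := signedIntegral μ (fun y => g ((i : ℤ) * h - y))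
  set a' := ∑ j ∈ Finset.Icc (-(N : ℤ)) N, h * gridRestrict h α' ((i : ℤ) - j) * f (g (j * h))
  set b' := ∑ j ∈ Finset.Icc (-(N : ℤ)) N, h * secondDiff h (gridRestrict h α') ((i : ℤ) - j)
    * g (j * h)
  have hMF0 : 0 ≤ MF := by positivity
  have e : -a - κ * b - (-a' - κ * b') = -(a - a') - κ * (b - b') := by ring
  rw [e]
  calc _ ≤ |a - a'| + |κ * (b - b')| := by
        refine (abs_sub _ _).trans ?_
        rw [abs_neg]
    _ ≤ _ := add_le_add e1 e2
    _ ≤ ((MF + L₁) * (h ^ 2 + δ)) * A + L₁ * M * (h ^ 2 + δ) * V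
          + κ * (((M + 1) * (h ^ 2 + δ)) * V) := by
        have h2 : 0 ≤ h ^ 2 := sq_nonneg h
        gcongr
        · nlinarith [mul_nonneg hMF0 hδ, mul_nonneg hL₁ h2]
        · nlinarith
        · nlinarith [mul_nonneg hM hδ]
    _ = _ := by ring

end KernelConditions

end

/-! ### Convergence of the truncated semi-discrete scheme -/

theorem IsCauchySolution.exists_regularity_const {α' : ℝ → ℝ} {μ : SignedMeasure ℝ} {f : ℝ → ℝ}
    {κ T s : ℝ} {φ : SobolevH s} {u : ℝ → SobolevH s} (hs : 5 / 2 < s)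
    (hu : IsCauchySolution α' μ f κ T φ u) :
    ∃ M : ℝ, 0 ≤ M ∧ ∀ t ∈ Icc 0 T, (∀ x, |(u t).rep x| ≤ M) ∧
      ∃ g' : ℝ → ℝ, (∀ x, HasDerivAt (u t).rep (g' x) x) ∧ (∀ x, |g' x| ≤ M) ∧
        ∀ x y, |g' x - g' y| ≤ M * |x - y| := by
  obtain ⟨C, hC, hemb⟩ := SobolevH.exists_embedding_const hs
  obtain ⟨B, hB⟩ := isCompact_Icc.exists_bound_of_continuousOn hu.contDiffOn.continuousOn
  refine ⟨C * max B 0, by positivity, fun t ht => ?_⟩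
  obtain ⟨-, -, h1, g', h2, h3, h4⟩ := hemb (u t)
  have hle : C * ‖u t‖ ≤ C * max B 0 :=
    mul_le_mul_of_nonneg_left ((hB t ht).trans (le_max_left _ _)) hC
  exact ⟨fun x => (h1 x).trans hle, g', h2, fun x => (h3 x).trans hle,
    fun x y => (h4 x y).trans (mul_le_mul_of_nonneg_right hle (abs_nonneg _))⟩

/-- The grid values of the exact solution solve the truncated system up to a small residual. -/
theorem IsCauchySolution.dist_deriv_gridValues_le {α' : ℝ → ℝ} {μ : SignedMeasure ℝ} {f : ℝ → ℝ}
    {κ T s : ℝ} {φ : SobolevH s} {u : ℝ → SobolevH s} (hs : 5 / 2 < s) (hT : 0 < T)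
    (hu : IsCauchySolution α' μ f κ T φ u) {h : ℝ} {N : ℕ} {K : NNReal} {E : ℝ} (hE : 0 ≤ E)
    {G : (TruncIdx N → ℝ) → TruncIdx N → ℝ} (hG : LipschitzWith K G)
    (hGu : ∀ t ∈ Icc 0 T, G (gridValues u h N t) = truncRHS α' f κ h N (gridValues u h N t))
    (hres : ∀ t ∈ Icc 0 T, ∀ i : TruncIdx N,
      |-(∫ y, α' ((i : ℤ) * h - y) * f ((u t).rep y))
        - κ * signedIntegral μ (fun y => (u t).rep ((i : ℤ) * h - y))
        - truncRHS α' f κ h N (gridValues u h N t) i| ≤ E) :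
    ∀ t ∈ Icc 0 T,
      dist (gridValues (derivWithin u (Icc 0 T)) h N t) (G (gridValues u h N t)) ≤ E := by
  have hpos : ∀ t ∈ Ioc 0 T,
      dist (gridValues (derivWithin u (Icc 0 T)) h N t) (G (gridValues u h N t)) ≤ E := by
    intro t ht
    have ht' := Ioc_subset_Icc_self ht
    rw [hGu t ht', dist_pi_le_iff hE]
    intro i
    rw [Real.dist_eq]
    refine le_trans (le_of_eq ?_) (hres t ht' i)
    congr 2
    have := hu.equation t ht.1 ht.2 ((i : ℤ) * h)
    change (derivWithin u (Icc 0 T) t).rep ((i : ℤ) * h) = _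
    linarith
  -- The equation is given only for `t > 0`; the bound reaches `t = 0` by continuity of both sides.
  have hc1 : ContinuousOn (gridValues (derivWithin u (Icc 0 T)) h N) (Icc 0 T) :=
    (hu.contDiffOn.continuousOn_derivWithin (uniqueDiffOn_Icc hT) le_rfl).gridValues hs h N
  have hc2 : ContinuousOn (fun t => G (gridValues u h N t)) (Icc 0 T) :=
    hG.continuous.comp_continuousOn (hu.contDiffOn.continuousOn.gridValues hs h N)
  intro t ht
  have hcl : closure (Ioc 0 T) = Icc 0 T := closure_Ioc hT.ne
  have hc := continuous_dist.comp_continuousOn (hc1.prodMk hc2)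
  exact le_on_closure hpos (by rw [hcl]; exact hc) continuousOn_const (by rwa [hcl])

theorem theorem4p2
    (α α' : ℝ → ℝ) (μ : SignedMeasure ℝ) (hα : KernelConditions α α' μ)
    (κ : ℝ) (hκ : 0 < κ)
    (s : ℝ) (hs : 9 / 2 < s)
    (f : ℝ → ℝ) (hf : ContDiff ℝ ((⌊s⌋₊ + 1 : ℕ) : WithTop ℕ∞) f) (hf0 : f 0 = 0)
    (T : ℝ) (hT : 0 < T)
    (φ : SobolevH s) (u : ℝ → SobolevH s) (hu : IsCauchySolution α' μ f κ T φ u) :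
    ∃ h₀ : ℝ, 0 < h₀ ∧ ∃ C : ℝ, ∀ h : ℝ, 0 < h → h ≤ h₀ → ∀ ε : ℝ, 0 < ε →
      ∃ N₀ : ℕ, ∀ N : ℕ, N₀ ≤ N →
        (∃ v : ℝ → TruncIdx N → ℝ,
          IsTruncSolution α' f κ h T N (truncate N (gridRestrict h φ.rep)) v) ∧
        ∀ v : ℝ → TruncIdx N → ℝ,
          IsTruncSolution α' f κ h T N (truncate N (gridRestrict h φ.rep)) v →
          ∀ t ∈ Icc 0 T, ∀ i : TruncIdx N,
            |(u t).rep ((i : ℤ) * h) - v t i| ≤ C * (h ^ 2 + ε) := by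
  have hs' : 5 / 2 < s := by linarith
  have hf2 : ContDiff ℝ 2 f := by
    refine hf.of_le ?_
    have : 2 ≤ ⌊s⌋₊ + 1 := by
      have : 1 ≤ ⌊s⌋₊ := Nat.le_floor (by push_cast; linarith)
      lia
    exact_mod_cast this
  have hf1 : ContDiff ℝ 1 f := hf2.of_le (by norm_num)
  obtain ⟨M, hM, hreg⟩ := hu.exists_regularity_const hs'
  obtain ⟨C₁, hC₁, hcons⟩ := hα.exists_consistency_const hκ.le hf2 hf0 hM
  -- One unit of room above the bound for `u`, so an error of at most 1 keeps the values unclamped.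
  set R := M + 1 with hR
  have hR0 : 0 ≤ R := by positivity
  obtain ⟨L, hL, -, hfL⟩ := exists_lipschitz_of_contDiff hf1 R
  set K := (KernelConditions.lipConst α' μ κ L).toNNReal with hK
  set γ := gronwallBound 0 K 1 T with hγ
  have hγ0 : 0 ≤ γ := by
    rw [← gronwallBound_x0 0 (K : ℝ) 1]
    exact gronwallBound_mono le_rfl zero_le_one K.2 hT.le
  set C := C₁ * γ with hC
  have hC0 : 0 ≤ C := by positivity
  -- Chosen so that `h² ≤ h ≤ η` and `δ ≤ η` force `C (h² + δ) ≤ 1`.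
  set η := 1 / (2 * (C + 1)) with hη
  have hη0 : 0 < η := by positivity
  have hηC : C * (η + η) ≤ 1 := by
    have : (C + 1) * (η + η) = 1 := by rw [hη]; field_simp; norm_num
    nlinarith
  refine ⟨min 1 η, by positivity, C, fun h hh hh₀ ε hε => ?_⟩
  have h1 : h ≤ 1 := hh₀.trans (min_le_left _ _)
  have hhη : h ≤ η := hh₀.trans (min_le_right _ _)
  -- The cap `η` keeps the clamp inactive even when `ε` is large.
  set δ := min ε η with hδ
  have hδ0 : 0 < δ := lt_min hε hη0
  obtain ⟨r, hr⟩ := SobolevH.exists_uniform_decay hs' hu.contDiffOn.continuousOn hδ0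
  -- The truncated grid then contains every node in `[-r, r]`, outside which `|u| ≤ δ`.
  refine ⟨⌈r / h⌉₊, fun N hN => ?_⟩
  have hout : ∀ t ∈ Icc 0 T, ∀ j : ℤ, j ∉ Finset.Icc (-(N : ℤ)) N → |(u t).rep (j * h)| ≤ δ := by
    intro t ht j hj
    refine hr _ ?_ t ht
    have hjN : (N : ℝ) < |(j : ℝ)| := by
      have : (N : ℤ) < |j| := by
        by_contra hcon
        exact hj (Finset.mem_Icc.2 (abs_le.1 (not_lt.1 hcon)))
      exact_mod_cast this
    have hrN : r / h ≤ N := (Nat.le_ceil _).trans (by exact_mod_cast hN)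
    rw [abs_mul, abs_of_pos hh, ← div_lt_iff₀ hh]
    exact hrN.trans_lt hjN
  set G := KernelConditions.clampedRHS α' f κ h N R
  have hGL : LipschitzWith K G := hα.lipschitzWith_clampedRHS hκ.le hh h1 hL hR0 hfL
  obtain ⟨v, hv0, hv⟩ := exists_solution_of_lipschitz_of_bounded hGL
    (hα.norm_clampedRHS_le hκ.le hh h1 hL hR0 hf0 hfL) hT.le (truncate N (gridRestrict h φ.rep))
  have hgM : ∀ t ∈ Icc 0 T, ∀ j, |gridValues u h N t j| ≤ M := fun t ht j => (hreg t ht).1 _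
  have hres := hu.dist_deriv_gridValues_le hs' hT (E := C₁ * (h ^ 2 + δ)) (by positivity) hGL
    (fun t ht => KernelConditions.clampedRHS_eq fun j => (hgM t ht j).trans (by linarith))
    (fun t ht i => by
      obtain ⟨hb, g', hg1, hg2, hg3⟩ := hreg t ht
      exact hcons _ g' hg1 hb hg2 hg3 h δ N hh hδ0.le (hout t ht) i)
  have hdist : ∀ t ∈ Icc 0 T, dist (gridValues u h N t) (v t) ≤ C * (h ^ 2 + δ) := by
    intro t ht
    have key := dist_le_of_approx_trajectories_ODE (v := fun _ => G) (δ := 0) (εg := 0)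
      (fun _ => hGL) (hu.contDiffOn.continuousOn.gridValues hs' h N)
      (fun t ht => (hu.contDiffOn.hasDerivWithinAt_gridValues hs' h N
        (Ico_subset_Icc_self ht)).Ici_of_Icc ht)
      (fun t ht => hres t (Ico_subset_Icc_self ht))
      (fun t ht => (hv t ht).continuousWithinAt)
      (fun t ht => (hv t (Ico_subset_Icc_self ht)).Ici_of_Icc ht)
      (fun t _ => by rw [dist_self])
      (by rw [hv0, gridValues, hu.initial, dist_self]) t ht
    rw [add_zero, sub_zero, gronwallBound_zero_eq_mul] at key
    refine key.trans ?_
    calc _ ≤ C₁ * (h ^ 2 + δ) * γ := by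
          refine mul_le_mul_of_nonneg_left ?_ (by positivity)
          exact gronwallBound_mono le_rfl zero_le_one K.2 ht.2
      _ = _ := by rw [hC]; ring
  have hsmall : C * (h ^ 2 + δ) ≤ 1 := by
    refine le_trans (mul_le_mul_of_nonneg_left (add_le_add ?_ (min_le_right _ _)) hC0) hηC
    nlinarith
  have hvR : ∀ t ∈ Icc 0 T, ∀ j, |v t j| ≤ R := by
    intro t ht j
    have hd := (dist_le_pi_dist _ _ j).trans ((hdist t ht).trans hsmall)
    have hg := hgM t ht j
    rw [Real.dist_eq] at hd
    rw [abs_le] at hd hg ⊢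
    constructor <;> linarith [hd.1, hd.2, hg.1, hg.2]
  have hsol : IsTruncSolution α' f κ h T N (truncate N (gridRestrict h φ.rep)) v :=
    ⟨hv0, fun t ht => by rw [← KernelConditions.clampedRHS_eq (hvR t ht)]; exact hv t ht⟩
  refine ⟨⟨v, hsol⟩, fun w hw t ht i => ?_⟩
  rw [← hα.truncSolution_unique hκ.le hh h1 hf1 hsol hw ht]
  calc _ = dist (gridValues u h N t i) (v t i) := rfl
    _ ≤ C * (h ^ 2 + δ) := (dist_le_pi_dist _ _ i).trans (hdist t ht)
    _ ≤ C * (h ^ 2 + ε) := by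
        have := min_le_left ε η
        gcongr
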